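/- Let $\mathbb P$ be Cohen forcing with locks: a condition is a tuple $p=(\sigma_0,\dots,\sigma_{k-1},f)$ with $k\in\omega$, $\sigma_0,\dots,\sigma_{k-1}\in 2^{<\omega}$ and $f:\{0,\dots,k-1\}\to\{0,1,u\}$. A condition $q=(\tau_0,\dots,\tau_{\ell-1},g)$ extends $p$, written $q\le p$, if $\ell\ge k$, $g$ extends $f$, $\sigma_i\preceq\tau_i$ for all $i<k$, and $\tau_i(x)=f(i)$ whenever $i<k$, $f(i)\in\{0,1\}$ and $|\sigma_i|\le x<|\tau_i|$. For a filter $\mathcal G$ on $\mathbb P$, let $R_i^{\mathcal G}=\{x : \sigma_i(x)=1 \text{ for some } (\sigma_0,\dots,\sigma_{k-1},f)\in\mathcal G \text{ with } k>i\}$ for $i\in\omega$, let $\vec R^{\mathcal G}=\langle R_0^{\mathcal G},R_1^{\mathcal G},\dots\rangle$, identified with $\{\langle i,x\rangle : x\in R_i^{\mathcal G}\}$, and let $f^{\mathcal G}=\bigcup\{f : (\sigma_0,\dots,\sigma_{k-1},f)\in\mathcal G\}$, identified with (the set of codes of) its graph. Call $\mathcal G$ $n$-generic if for every $\Sigma^0_n$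 set $W$ of conditions, $\mathcal G$ contains an element of $W$ or a condition with no extension in $W$. A set $X\subseteq\omega$ is of PA degree relative to $Y\subseteq\omega$ if every infinite $Y$-computable tree $T\subseteq 2^{<\omega}$ has an $X$-computable infinite path. Theorem. If $\mathcal G$ is a sufficiently generic filter on $\mathbb P$, then $(\vec R^{\mathcal G}\oplus f^{\mathcal G})'$ is not of PA degree relative to $\emptyset'$. That is, there is an $n\in\omega$ such that for every $n$-generic filter $\mathcal G$ on $\mathbb P$, $(\vec R^{\mathcal G}\oplus f^{\mathcal G})'$ is not of PA degree relative to $\emptyset'$. -/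

import Mathlib

open Classical in
/-- The characteristic function of `A ⊆ ω`, as an oracle. -/
noncomputable def oracleOf (A : Set ℕ) : ℕ →. ℕ :=
  fun n => Part.some (if n ∈ A then 1 else 0)

/-- Programs with an oracle, with one constructor for each clause of `Nat.RecursiveIn`. -/
inductive OracleCode : Type
  | zero : OracleCode
  | succ : OracleCode
  | left : OracleCode
  | right : OracleCode
  | oracle : OracleCode
  | pair : OracleCode → OracleCode → OracleCode
  | comp : OracleCode → OracleCode → OracleCode
  | prec : OracleCode → OracleCode → OracleCode
  | rfind : OracleCode → OracleCode

namespace OracleCode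

/-- The partial function computed by a program with oracle `A`. -/
noncomputable def eval (A : Set ℕ) : OracleCode → ℕ →. ℕ
  | zero => fun _ => Part.some 0
  | succ => fun n => Part.some (n + 1)
  | left => fun n => Part.some n.unpair.1
  | right => fun n => Part.some n.unpair.2
  | oracle => oracleOf A
  | pair c d => fun n => Nat.pair <$> eval A c n <*> eval A d n
  | comp c d => fun n => eval A d n >>= eval A c
  | prec c d => fun p =>
      let (a, n) := Nat.unpair p
      n.rec (eval A c a) fun y IH => do
        let i ← IH
        eval A d (Nat.pair a (Nat.pair y i))
  | rfind c => fun a => Nat.rfind fun n => (fun m => m = 0) <$> eval A c (Nat.pair a n)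

/-- The index (Gödel number) of a program. -/
def index : OracleCode → ℕ
  | zero => 0
  | succ => 1
  | left => 2
  | right => 3
  | oracle => 4
  | pair c d => 4 * Nat.pair c.index d.index + 5
  | comp c d => 4 * Nat.pair c.index d.index + 6
  | prec c d => 4 * Nat.pair c.index d.index + 7
  | rfind c => 4 * c.index + 8

/-- Distinct programs have distinct indices. -/
theorem index_injective : Function.Injective index := by
  intro c
  induction c with
  | zero | succ | left | right | oracle =>
    intro d h; cases d <;> simp [index] at h ⊢
  | pair a b iha ihb =>
    intro d h
    cases d <;> simp only [index] at h <;> try omega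
    rename_i c d
    obtain ⟨h1, h2⟩ := Nat.pair_eq_pair.1
      (show Nat.pair a.index b.index = Nat.pair c.index d.index by omega)
    rw [iha h1, ihb h2]
  | comp a b iha ihb =>
    intro d h
    cases d <;> simp only [index] at h <;> try omega
    rename_i c d
    obtain ⟨h1, h2⟩ := Nat.pair_eq_pair.1
      (show Nat.pair a.index b.index = Nat.pair c.index d.index by omega)
    rw [iha h1, ihb h2]
  | prec a b iha ihb =>
    intro d h
    cases d <;> simp only [index] at h <;> try omega
    rename_i c d
    obtain ⟨h1, h2⟩ := Nat.pair_eq_pair.1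
      (show Nat.pair a.index b.index = Nat.pair c.index d.index by omega)
    rw [iha h1, ihb h2]
  | rfind a iha =>
    intro d h
    cases d <;> simp only [index] at h <;> try omega
    rename_i c
    rw [iha (show a.index = c.index by omega)]

/-- The programs with oracle `A` compute exactly the partial `A`-computable functions. -/
theorem exists_eval_eq_iff (A : Set ℕ) (f : ℕ →. ℕ) :
    (∃ c : OracleCode, eval A c = f) ↔ Nat.RecursiveIn {oracleOf A} f := by
  constructor
  · rintro ⟨c, rfl⟩
    induction c with
    | zero => exact .zero
    | succ => exact .succ
    | left => exact .left
    | right => exact .right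
    | oracle => exact .oracle _ rfl
    | pair c d ihc ihd => exact .pair ihc ihd
    | comp c d ihc ihd => exact .comp ihc ihd
    | prec c d ihc ihd => exact .prec ihc ihd
    | rfind c ihc => exact .rfind ihc
  · intro hf
    induction hf with
    | zero => exact ⟨.zero, rfl⟩
    | succ => exact ⟨.succ, rfl⟩
    | left => exact ⟨.left, rfl⟩
    | right => exact ⟨.right, rfl⟩
    | oracle g hg => exact ⟨.oracle, (Set.mem_singleton_iff.1 hg).symm⟩
    | pair _ _ ihc ihd =>
      obtain ⟨c, rfl⟩ := ihc
      obtain ⟨d, rfl⟩ := ihd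
      exact ⟨.pair c d, rfl⟩
    | comp _ _ ihc ihd =>
      obtain ⟨c, rfl⟩ := ihc
      obtain ⟨d, rfl⟩ := ihd
      exact ⟨.comp c d, rfl⟩
    | prec _ _ ihc ihd =>
      obtain ⟨c, rfl⟩ := ihc
      obtain ⟨d, rfl⟩ := ihd
      exact ⟨.prec c d, rfl⟩
    | rfind _ ihc =>
      obtain ⟨c, rfl⟩ := ihc
      exact ⟨.rfind c, rfl⟩

end OracleCode

/-- The Turing jump `A' = {e : Φ_e^A(e) ↓}`. -/
def turingJump (A : Set ℕ) : Set ℕ :=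
  {e | ∃ c : OracleCode, c.index = e ∧ (c.eval A e).Dom}

/-- The join `A ⊕ B = {2n : n ∈ A} ∪ {2n + 1 : n ∈ B}`. -/
def turingJoin (A B : Set ℕ) : Set ℕ :=
  (fun n => 2 * n) '' A ∪ (fun n => 2 * n + 1) '' B

open Classical in
/-- `S` is an `A`-computable set. -/
def IsComputableIn {α : Type} [Primcodable α] (A : Set ℕ) (S : Set α) : Prop :=
  ComputableIn {oracleOf A} (fun a : α => decide (a ∈ S))

/-- `S` is computably enumerable in `A`: it is the domain of a partial `A`-computable function. -/
def IsCEIn {α : Type} [Primcodable α] (A : Set ℕ) (S : Set α) : Prop :=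
  RecursiveIn {oracleOf A} (fun a : α => Part.assert (a ∈ S) fun _ => Part.some ())

/-- `S` is `Σ⁰_n`: computable if `n = 0`, and c.e. in `∅⁽ⁿ⁻¹⁾` if `n ≥ 1`. -/
def IsSigmaZero {α : Type} [Primcodable α] : ℕ → Set α → Prop
  | 0, S => IsComputableIn ∅ S
  | n + 1, S => IsCEIn (turingJump^[n] ∅) S

/-- `T ⊆ 2^{<ω}` is a tree: it is closed under initial segments. -/
def IsBinaryTree (T : Set (List Bool)) : Prop :=
  ∀ σ τ : List Bool, σ <+: τ → τ ∈ T → σ ∈ T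

/-- `P ∈ 2^ω` is an infinite path through `T`: every `P ↾ n` is in `T`. -/
def IsPathThrough (P : ℕ → Bool) (T : Set (List Bool)) : Prop :=
  ∀ n : ℕ, (List.range n).map P ∈ T

/-- `X` is of PA degree relative to `Y` (`deg X ≫ deg Y`): every infinite `Y`-computable binary
tree has an `X`-computable infinite path. -/
def IsPADegreeRelativeTo (X Y : Set ℕ) : Prop :=
  ∀ T : Set (List Bool), IsBinaryTree T → T.Infinite → IsComputableIn Y T →
    ∃ P : ℕ → Bool, ComputableIn {oracleOf X} P ∧ IsPathThrough P T

/-- The values `{0, 1, u}` of a lock: `some b` is the bit `b`, and `none` is `u` (unlocked). -/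
abbrev Lock : Type := Option Bool

/-- A condition `(σ_0, …, σ_{k-1}, f)` of Cohen forcing with locks, as the list
`(σ_0, f(0)), …, (σ_{k-1}, f(k-1))` of length `k`. -/
@[ext]
structure LockCondition where
  columns : List (List Bool × Lock)

namespace LockCondition

/-- A condition is the same thing as its list of columns. -/
def equivList : LockCondition ≃ List (List Bool × Lock) where
  toFun p := p.columns
  invFun l := ⟨l⟩
  left_inv _ := rfl
  right_inv _ := rfl

instance : Primcodable LockCondition := Primcodable.ofEquiv _ equivList

/-- `q` extends `p`: every column `(σ, a)` of `p` is continued by the column `(τ, a)` of `q` with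
the same number, where `σ ⪯ τ`, and all new bits of `τ` are `b` if `a` is the bit `b`. -/
def Extends (q p : LockCondition) : Prop :=
  p.columns.length ≤ q.columns.length ∧
    ∀ (i : ℕ) (σ : List Bool) (a : Lock), p.columns[i]? = some (σ, a) →
      ∃ τ : List Bool, q.columns[i]? = some (τ, a) ∧ σ <+: τ ∧
        ∀ b : Bool, a = some b → ∀ x : ℕ, σ.length ≤ x → x < τ.length → τ[x]? = some b

instance : Preorder LockCondition where
  le q p := Extends q p
  le_refl p := ⟨le_rfl, fun i σ a h => ⟨σ, h, List.prefix_rfl, fun _ _ x h1 h2 => by omega⟩⟩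
  le_trans r q p hrq hqp := by
    refine ⟨hqp.1.trans hrq.1, fun i σ a h => ?_⟩
    obtain ⟨τ, hτ, hστ, hb⟩ := hqp.2 i σ a h
    obtain ⟨ρ, hρ, hτρ, hb'⟩ := hrq.2 i τ a hτ
    refine ⟨ρ, hρ, hστ.trans hτρ, fun b hab x h1 h2 => ?_⟩
    by_cases hx : x < τ.length
    · have := hb b hab x h1 hx
      obtain ⟨t, rfl⟩ := hτρ
      rw [List.getElem?_append_left hx, this]
    · exact hb' b hab x (by omega) h2

end LockCondition

/-- `G` is `n`-generic: for every `Σ⁰_n` set `W` of conditions, `G` contains an element of `W` or a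
condition that has no extension in `W`. -/
def IsNGeneric (n : ℕ) (G : Order.PFilter LockCondition) : Prop :=
  ∀ W : Set LockCondition, IsSigmaZero n W →
    (∃ p ∈ G, p ∈ W) ∨ ∃ p ∈ G, ∀ q : LockCondition, q ≤ p → q ∉ W

/-- The set `R_i^G`: the union over `G` of the strings `σ_i`, viewed as finite sets. -/
def genericColumn (G : Order.PFilter LockCondition) (i : ℕ) : Set ℕ :=
  {x | ∃ p ∈ G, ∃ (σ : List Bool) (a : Lock), p.columns[i]? = some (σ, a) ∧ σ[x]? = some true}

/-- The graph of `f^G`: the union over `G` of the graphs of the functions `f`. -/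
def genericLockGraph (G : Order.PFilter LockCondition) : Set (ℕ × Lock) :=
  {z | ∃ p ∈ G, ∃ σ : List Bool, p.columns[z.1]? = some (σ, z.2)}

/-- The sequence `⟨R_0^G, R_1^G, …⟩` as the set `{⟨i, x⟩ : x ∈ R_i^G}`. -/
def genericSequence (G : Order.PFilter LockCondition) : Set ℕ :=
  {m | m.unpair.2 ∈ genericColumn G m.unpair.1}

/-- `f^G` as a subset of `ω`, through its graph. -/
def genericLocks (G : Order.PFilter LockCondition) : Set ℕ :=
  Encodable.encode '' genericLockGraph G

/-! Let $A = R \oplus f$ be the join given by a 2-generic filter $\mathcal G$. The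
$\emptyset'$-computable tree is `diagonalTree`, whose paths are the $\{0,1\}$-valued functions $P$
with $P(e) \ne \Phi_e^{\emptyset'}(e)$ for all $e$. So it is enough that every total function
$\Phi_d^{A'}$ agrees somewhere with the diagonal function $e \mapsto \Phi_e^{\emptyset'}(e)$.

A condition decides a single value of $A'$ either by carrying a finite halting computation or by
having no extension that carries one. Since extension and the bits of $A$ fixed by a condition are
primitive recursive, $\emptyset'$ decides whether a condition forces finitely many values of $A'$
(`exists_primrec_forcesFacts`). Hence the set $W$ of conditions that force $\Phi_d^{A'}(e) =
\Phi_e^{\emptyset'}(e)$ for some $e$ is $\Sigma^0_2$ (`isSigmaZero_forcesDiagonal`).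

If $\mathcal G$ meets $W$, the agreement holds. Otherwise some $p \in \mathcal G$ has no extension
in $W$. Suppose that for every $x$ some extension of $p$ forced a value of $\Phi_d^{A'}(x)$. Then
$\emptyset'$ could search for such a value, giving a total function $\Phi_c^{\emptyset'}$, and the
condition found at $x = c$ would extend $p$ and lie in $W$. So some $x$ gets no forced value below
$p$ (`exists_not_forced_value`), which contradicts totality, because by genericity every true
computation from $A'$ is forced by a member of $\mathcal G$
(`IsNGeneric.correctFor_turingJump_iff`).

Locks need no special treatment: $f$ is part of the oracle, so a condition decides the lock of each
of its columns outright. Oracle computations are handled through finite lists of facts, so that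
having a computation is a primitive recursive property of its code. -/

open Encodable

/-! ### Closure properties of primitive recursive predicates -/

section PrimrecHelpers

variable {α β : Type*} [Primcodable α] [Primcodable β]

theorem PrimrecPred.exists_mem {f : α → List β} {R : α → β → Prop} (hf : Primrec f)
    (hR : PrimrecPred fun p : α × β => R p.1 p.2) : PrimrecPred fun a => ∃ b ∈ f a, R a b := by
  have h : PrimrecRel fun (b : β) (a : α) => R a b :=
    (hR.comp (Primrec.pair Primrec.snd Primrec.fst)).primrecRel
  exact (PrimrecRel.exists_mem_list h).comp hf Primrec.id

theorem PrimrecPred.forall_mem {f : α → List β} {R : α → β → Prop} (hf : Primrec f)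
    (hR : PrimrecPred fun p : α × β => R p.1 p.2) : PrimrecPred fun a => ∀ b ∈ f a, R a b := by
  have h : PrimrecRel fun (b : β) (a : α) => R a b :=
    (hR.comp (Primrec.pair Primrec.snd Primrec.fst)).primrecRel
  exact (PrimrecRel.forall_mem_list h).comp hf Primrec.id

theorem PrimrecPred.imp {p q : α → Prop} (hp : PrimrecPred p) (hq : PrimrecPred q) :
    PrimrecPred fun a => p a → q a :=
  (hp.not.or hq).of_eq fun _ => by tauto

theorem PrimrecPred.eq {f g : α → β} (hf : Primrec f) (hg : Primrec g) :
    PrimrecPred fun a => f a = g a := by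
  exact Primrec.eq.comp hf hg

theorem PrimrecPred.mem {f : α → β} {g : α → List β} (hf : Primrec f) (hg : Primrec g) :
    PrimrecPred fun a => f a ∈ g a :=
  (PrimrecPred.exists_mem (R := fun a b => b = f a) hg
    (PrimrecPred.eq Primrec.snd (hf.comp Primrec.fst))).of_eq fun a => by simp

theorem PrimrecPred.forall_lt_of {f : α → ℕ} {R : α → ℕ → Prop} (hf : Primrec f)
    (hR : PrimrecPred fun p : α × ℕ => R p.1 p.2) : PrimrecPred fun a => ∀ n < f a, R a n :=
  (PrimrecPred.forall_mem (Primrec.list_range.comp hf) hR).of_eq fun a => by simp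

theorem PrimrecPred.exists_lt_of {f : α → ℕ} {R : α → ℕ → Prop} (hf : Primrec f)
    (hR : PrimrecPred fun p : α × ℕ => R p.1 p.2) : PrimrecPred fun a => ∃ n < f a, R a n :=
  (PrimrecPred.exists_mem (Primrec.list_range.comp hf) hR).of_eq fun a => by simp

end PrimrecHelpers

/-! ### Finite derivations as certificates for oracle computations -/

/-- A fact `(c, n, v)` claims that the program of index `c` with input `n` has value `v`. -/
abbrev ComputationFact : Type := ℕ × ℕ × ℕ

/-- The fact `t` follows from the facts in `L` by one clause of the definition of
`OracleCode.eval`. Facts about the oracle itself are always accepted. -/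
def Justified (L : List ComputationFact) (t : ComputationFact) : Prop :=
  (t.1 = 0 ∧ t.2.2 = 0) ∨ (t.1 = 1 ∧ t.2.2 = t.2.1 + 1) ∨
  (t.1 = 2 ∧ t.2.2 = t.2.1.unpair.1) ∨ (t.1 = 3 ∧ t.2.2 = t.2.1.unpair.2) ∨ t.1 = 4 ∨
  (∃ r ∈ L, ∃ s ∈ L, t.1 = 4 * Nat.pair r.1 s.1 + 5 ∧ r.2.1 = t.2.1 ∧ s.2.1 = t.2.1 ∧
    t.2.2 = Nat.pair r.2.2 s.2.2) ∨
  (∃ r ∈ L, ∃ s ∈ L, t.1 = 4 * Nat.pair r.1 s.1 + 6 ∧ s.2.1 = t.2.1 ∧ r.2.1 = s.2.2 ∧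
    t.2.2 = r.2.2) ∨
  (t.2.1.unpair.2 = 0 ∧ ∃ r ∈ L, ∃ d < t.1, t.1 = 4 * Nat.pair r.1 d + 7 ∧
    r.2.1 = t.2.1.unpair.1 ∧ t.2.2 = r.2.2) ∨
  (∃ r ∈ L, ∃ s ∈ L, ∃ a < t.1, t.1 = 4 * Nat.pair a s.1 + 7 ∧ r.1 = t.1 ∧
    t.2.1 = Nat.pair r.2.1.unpair.1 (r.2.1.unpair.2 + 1) ∧
    s.2.1 = Nat.pair r.2.1.unpair.1 (Nat.pair r.2.1.unpair.2 r.2.2) ∧ t.2.2 = s.2.2) ∨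
  (∃ r ∈ L, t.1 = 4 * r.1 + 8 ∧ r.2.1 = Nat.pair t.2.1 t.2.2 ∧ r.2.2 = 0 ∧
    ∀ m < t.2.2, ∃ s ∈ L, s.1 = r.1 ∧ s.2.1 = Nat.pair t.2.1 m ∧ s.2.2 ≠ 0)

/-- `L` is a derivation: each of its facts follows from the others. -/
def IsDerivation (L : List ComputationFact) : Prop := ∀ t ∈ L, Justified L t

/-- The facts about the oracle in `L` are true of `A`. -/
def CorrectFor (A : Set ℕ) (L : List ComputationFact) : Prop :=
  ∀ t ∈ L, t.1 = 4 → t.2.2 ∈ oracleOf A t.2.1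

theorem Justified.mono {L M : List ComputationFact} (h : L ⊆ M) {t : ComputationFact}
    (ht : Justified L t) : Justified M t := by
  rcases ht with ht | ht | ht | ht | ht | ⟨r, hr, s, hs, ht⟩ | ⟨r, hr, s, hs, ht⟩ |
    ⟨h0, r, hr, ht⟩ | ⟨r, hr, s, hs, ht⟩ | ⟨r, hr, h1, h2, h3, h4⟩
  · exact .inl ht
  · exact .inr (.inl ht)
  · exact .inr (.inr (.inl ht))
  · exact .inr (.inr (.inr (.inl ht)))
  · exact .inr (.inr (.inr (.inr (.inl ht))))
  · exact .inr (.inr (.inr (.inr (.inr (.inl ⟨r, h hr, s, h hs, ht⟩)))))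
  · exact .inr (.inr (.inr (.inr (.inr (.inr (.inl ⟨r, h hr, s, h hs, ht⟩))))))
  · exact .inr (.inr (.inr (.inr (.inr (.inr (.inr (.inl ⟨h0, r, h hr, ht⟩)))))))
  · exact .inr (.inr (.inr (.inr (.inr (.inr (.inr (.inr (.inl ⟨r, h hr, s, h hs, ht⟩))))))))
  · refine .inr (.inr (.inr (.inr (.inr (.inr (.inr (.inr (.inr ⟨r, h hr, h1, h2, h3, ?_⟩))))))))
    intro m hm
    obtain ⟨s, hs, hs'⟩ := h4 m hm
    exact ⟨s, h hs, hs'⟩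

theorem IsDerivation.append {L M : List ComputationFact} (hL : IsDerivation L)
    (hM : IsDerivation M) : IsDerivation (L ++ M) := by
  intro t ht
  rcases List.mem_append.1 ht with ht | ht
  · exact (hL t ht).mono (List.subset_append_left _ _)
  · exact (hM t ht).mono (List.subset_append_right _ _)

theorem IsDerivation.cons {L : List ComputationFact} {t : ComputationFact} (hL : IsDerivation L)
    (ht : Justified L t) : IsDerivation (t :: L) := by
  intro s hs
  rcases List.mem_cons.1 hs with rfl | hs
  · exact ht.mono (List.subset_cons_self _ _)
  · exact (hL s hs).mono (List.subset_cons_self _ _)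

theorem CorrectFor.append {A : Set ℕ} {L M : List ComputationFact} (hL : CorrectFor A L)
    (hM : CorrectFor A M) : CorrectFor A (L ++ M) := by
  intro t ht
  rcases List.mem_append.1 ht with ht | ht
  · exact hL t ht
  · exact hM t ht

theorem CorrectFor.cons {A : Set ℕ} {L : List ComputationFact} {t : ComputationFact}
    (hL : CorrectFor A L) (ht : t.1 = 4 → t.2.2 ∈ oracleOf A t.2.1) : CorrectFor A (t :: L) := by
  intro s hs
  rcases List.mem_cons.1 hs with rfl | hs
  · exact ht
  · exact hL s hs

/-- Every quantifier runs over the list or is bounded by an entry of `t`. This is why the clauses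
for `prec` bound the index of the subprogram that has no fact of its own by `t.1`. -/
theorem primrecPred_justified :
    PrimrecPred fun p : List ComputationFact × ComputationFact => Justified p.1 p.2 := by
  unfold Justified
  have c0 : ∀ {α : Type} [Primcodable α] (k : ℕ), Primrec fun _ : α => k :=
    fun k => Primrec.const k
  have idx : ∀ {α : Type} [Primcodable α] {f g : α → ℕ} (k : ℕ), Primrec f → Primrec g →
      Primrec fun a => 4 * Nat.pair (f a) (g a) + k := fun k hf hg =>
    Primrec.nat_add.comp (Primrec.nat_mul.comp (c0 4) (Primrec₂.natPair.comp hf hg)) (c0 k)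
  have up1 : ∀ {α : Type} [Primcodable α] {f : α → ℕ}, Primrec f →
      Primrec fun a => (f a).unpair.1 := fun hf => Primrec.fst.comp (Primrec.unpair.comp hf)
  have up2 : ∀ {α : Type} [Primcodable α] {f : α → ℕ}, Primrec f →
      Primrec fun a => (f a).unpair.2 := fun hf => Primrec.snd.comp (Primrec.unpair.comp hf)
  have s1 : ∀ {α : Type} [Primcodable α] {f : α → ComputationFact}, Primrec f →
      Primrec fun a => (f a).1 := fun hf => Primrec.fst.comp hf
  have s2 : ∀ {α : Type} [Primcodable α] {f : α → ComputationFact}, Primrec f →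
      Primrec fun a => (f a).2.1 := fun hf => Primrec.fst.comp (Primrec.snd.comp hf)
  have s3 : ∀ {α : Type} [Primcodable α] {f : α → ComputationFact}, Primrec f →
      Primrec fun a => (f a).2.2 := fun hf => Primrec.snd.comp (Primrec.snd.comp hf)
  have L0 : Primrec fun p : List ComputationFact × ComputationFact => p.1 := Primrec.fst
  have t0 : Primrec fun p : List ComputationFact × ComputationFact => p.2 := Primrec.snd
  have L1 : Primrec fun p : (List ComputationFact × ComputationFact) × ComputationFact => p.1.1 :=
    L0.comp Primrec.fst
  have t1 : Primrec fun p : (List ComputationFact × ComputationFact) × ComputationFact => p.1.2 :=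
    t0.comp Primrec.fst
  have r1 : Primrec fun p : (List ComputationFact × ComputationFact) × ComputationFact => p.2 :=
    Primrec.snd
  refine .or (.and (.eq (s1 t0) (c0 0)) (.eq (s3 t0) (c0 0))) ?_
  refine .or (.and (.eq (s1 t0) (c0 1)) (.eq (s3 t0) (Primrec.succ.comp (s2 t0)))) ?_
  refine .or (.and (.eq (s1 t0) (c0 2)) (.eq (s3 t0) (up1 (s2 t0)))) ?_
  refine .or (.and (.eq (s1 t0) (c0 3)) (.eq (s3 t0) (up2 (s2 t0)))) ?_
  refine .or (.eq (s1 t0) (c0 4)) ?_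
  refine .or (.exists_mem L0 (.exists_mem L1 ?_)) ?_
  · have t2 := t1.comp (Primrec.fst (α := _ × _) (β := ComputationFact))
    have r2 := r1.comp (Primrec.fst (α := _ × _) (β := ComputationFact))
    have q2 : Primrec (fun p : ((List ComputationFact × ComputationFact) × ComputationFact) ×
      ComputationFact => p.2) := Primrec.snd
    exact .and (.eq (s1 t2) (idx 5 (s1 r2) (s1 q2))) (.and (.eq (s2 r2) (s2 t2))
      (.and (.eq (s2 q2) (s2 t2)) (.eq (s3 t2) (Primrec₂.natPair.comp (s3 r2) (s3 q2)))))
  refine .or (.exists_mem L0 (.exists_mem L1 ?_)) ?_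
  · have t2 := t1.comp (Primrec.fst (α := _ × _) (β := ComputationFact))
    have r2 := r1.comp (Primrec.fst (α := _ × _) (β := ComputationFact))
    have q2 : Primrec (fun p : ((List ComputationFact × ComputationFact) × ComputationFact) ×
      ComputationFact => p.2) := Primrec.snd
    exact .and (.eq (s1 t2) (idx 6 (s1 r2) (s1 q2))) (.and (.eq (s2 q2) (s2 t2))
      (.and (.eq (s2 r2) (s3 q2)) (.eq (s3 t2) (s3 r2))))
  refine .or (.and (.eq (up2 (s2 t0)) (c0 0)) (.exists_mem L0 (.exists_lt_of (s1 t1) ?_))) ?_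
  · have t2 := t1.comp (Primrec.fst (α := _ × _) (β := ℕ))
    have r2 := r1.comp (Primrec.fst (α := _ × _) (β := ℕ))
    exact .and (.eq (s1 t2) (idx 7 (s1 r2) Primrec.snd)) (.and (.eq (s2 r2) (up1 (s2 t2)))
      (.eq (s3 t2) (s3 r2)))
  refine .or (.exists_mem L0 (.exists_mem L1 (.exists_lt_of
    (s1 (t1.comp Primrec.fst)) ?_))) ?_
  · have t3 := t1.comp ((Primrec.fst (α := _ × _) (β := ComputationFact)).comp
      (Primrec.fst (α := _ × _) (β := ℕ)))
    have r3 := r1.comp ((Primrec.fst (α := _ × _) (β := ComputationFact)).comp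
      (Primrec.fst (α := _ × _) (β := ℕ)))
    have q3 : Primrec (fun p : (((List ComputationFact × ComputationFact) × ComputationFact) ×
      ComputationFact) × ℕ => p.1.2) := Primrec.snd.comp Primrec.fst
    exact .and (.eq (s1 t3) (idx 7 Primrec.snd (s1 q3))) (.and (.eq (s1 r3) (s1 t3))
      (.and (.eq (s2 t3) (Primrec₂.natPair.comp (up1 (s2 r3)) (Primrec.succ.comp (up2 (s2 r3)))))
      (.and (.eq (s2 q3) (Primrec₂.natPair.comp (up1 (s2 r3))
        (Primrec₂.natPair.comp (up2 (s2 r3)) (s3 r3)))) (.eq (s3 t3) (s3 q3)))))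
  refine .exists_mem L0 (.and (.eq (s1 t1) (Primrec.nat_add.comp (Primrec.nat_mul.comp (c0 4)
    (s1 r1)) (c0 8))) (.and (.eq (s2 r1) (Primrec₂.natPair.comp (s2 t1) (s3 t1)))
    (.and (.eq (s3 r1) (c0 0)) (.forall_lt_of (s3 t1) (.exists_mem (L1.comp Primrec.fst) ?_)))))
  have t3 := t1.comp ((Primrec.fst (α := _ × _) (β := ℕ)).comp
    (Primrec.fst (α := _ × _) (β := ComputationFact)))
  have r3 := r1.comp ((Primrec.fst (α := _ × _) (β := ℕ)).comp
    (Primrec.fst (α := _ × _) (β := ComputationFact)))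
  have m3 : Primrec (fun p : (((List ComputationFact × ComputationFact) × ComputationFact) ×
      ℕ) × ComputationFact => p.1.2) := Primrec.snd.comp Primrec.fst
  have q3 : Primrec (fun p : (((List ComputationFact × ComputationFact) × ComputationFact) ×
      ℕ) × ComputationFact => p.2) := Primrec.snd
  exact .and (.eq (s1 q3) (s1 r3)) (.and (.eq (s2 q3) (Primrec₂.natPair.comp (s2 t3) m3))
    (PrimrecPred.not (.eq (s3 q3) (c0 0))))

theorem primrecPred_isDerivation : PrimrecPred IsDerivation :=
  PrimrecPred.forall_mem Primrec.id primrecPred_justified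

theorem oracleOf_mem_iff {A : Set ℕ} {n v : ℕ} :
    v ∈ oracleOf A n ↔ (v = 1 ∧ n ∈ A) ∨ (v = 0 ∧ n ∉ A) := by
  classical
  by_cases h : n ∈ A <;> simp [oracleOf, h]

theorem OracleCode.mem_eval_prec_iff {A : Set ℕ} {c d : OracleCode} {a y v : ℕ} :
    (v ∈ (OracleCode.prec c d).eval A (Nat.pair a 0) ↔ v ∈ c.eval A a) ∧
    (v ∈ (OracleCode.prec c d).eval A (Nat.pair a (y + 1)) ↔
      ∃ i ∈ (OracleCode.prec c d).eval A (Nat.pair a y),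
        v ∈ d.eval A (Nat.pair a (Nat.pair y i))) := by
  constructor <;> simp [OracleCode.eval]

theorem OracleCode.mem_eval_rfind_iff {A : Set ℕ} {c : OracleCode} {a v : ℕ} :
    v ∈ (OracleCode.rfind c).eval A a ↔ 0 ∈ c.eval A (Nat.pair a v) ∧
      ∀ m < v, ∃ w ∈ c.eval A (Nat.pair a m), w ≠ 0 := by
  simp only [OracleCode.eval]
  refine Nat.mem_rfind.trans ?_
  simp

theorem OracleCode.mem_eval_pair_iff {A : Set ℕ} {c d : OracleCode} {n v : ℕ} :
    v ∈ (OracleCode.pair c d).eval A n ↔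
      ∃ x ∈ c.eval A n, ∃ y ∈ d.eval A n, v = Nat.pair x y := by
  simp [OracleCode.eval, Seq.seq, eq_comm]

theorem OracleCode.mem_eval_comp_iff {A : Set ℕ} {c d : OracleCode} {n v : ℕ} :
    v ∈ (OracleCode.comp c d).eval A n ↔ ∃ x ∈ d.eval A n, v ∈ c.eval A x := by
  simp only [OracleCode.eval]
  exact Part.mem_bind_iff

/-- A derivation carries no order, so it could be circular on its face. It is sound nevertheless:
each clause appeals to a proper subprogram or, for `prec`, to the same program at a smaller
recursion argument, so induction on the program and then on that argument applies. -/
theorem IsDerivation.sound {A : Set ℕ} {L : List ComputationFact} (hL : IsDerivation L)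
    (hA : CorrectFor A L) (c : OracleCode) (n v : ℕ) (h : (c.index, n, v) ∈ L) :
    v ∈ c.eval A n := by
  induction c generalizing n v with
  | zero =>
    have := hL _ h
    simp [Justified, OracleCode.index] at this
    simp [OracleCode.eval, this]
  | succ =>
    have := hL _ h
    simp [Justified, OracleCode.index] at this
    simp [OracleCode.eval, this]
  | left =>
    have := hL _ h
    simp [Justified, OracleCode.index] at this
    simp [OracleCode.eval, this]
  | right =>
    have := hL _ h
    simp [Justified, OracleCode.index] at this
    simp [OracleCode.eval, this]
  | oracle => exact hA _ h rfl
  | pair c d ihc ihd =>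
    rcases hL _ h with ht | ht | ht | ht | ht | ⟨r, hr, s, hs, ht⟩ | ⟨r, hr, s, hs, ht⟩ |
      ⟨h0, r, hr, d, hd, ht⟩ | ⟨r, hr, s, hs, a, ha, ht⟩ | ⟨r, hr, ht⟩ <;>
      simp only [OracleCode.index] at ht <;> try omega
    obtain ⟨rc, rn, rv⟩ := r
    obtain ⟨sc, sn, sv⟩ := s
    obtain ⟨h1, h2, h3, h4⟩ := ht
    dsimp only at h1
    obtain ⟨h5, h6⟩ := Nat.pair_eq_pair.1 (show Nat.pair c.index d.index = Nat.pair rc sc by omega)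
    simp only at h2 h3 h4
    subst h2 h3 h5 h6
    exact OracleCode.mem_eval_pair_iff.2 ⟨rv, ihc _ _ hr, sv, ihd _ _ hs, h4⟩
  | comp c d ihc ihd =>
    rcases hL _ h with ht | ht | ht | ht | ht | ⟨r, hr, s, hs, ht⟩ | ⟨r, hr, s, hs, ht⟩ |
      ⟨h0, r, hr, d, hd, ht⟩ | ⟨r, hr, s, hs, a, ha, ht⟩ | ⟨r, hr, ht⟩ <;>
      simp only [OracleCode.index] at ht <;> try omega
    obtain ⟨rc, rn, rv⟩ := r
    obtain ⟨sc, sn, sv⟩ := s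
    obtain ⟨h1, h2, h3, h4⟩ := ht
    dsimp only at h1
    obtain ⟨h5, h6⟩ := Nat.pair_eq_pair.1 (show Nat.pair c.index d.index = Nat.pair rc sc by omega)
    simp only at h2 h3 h4
    subst h2 h3 h4 h5 h6
    exact OracleCode.mem_eval_comp_iff.2 ⟨_, ihd _ _ hs, ihc _ _ hr⟩
  | prec c d ihc ihd =>
    obtain ⟨m, y, rfl⟩ : ∃ m y, n = Nat.pair m y := ⟨_, _, (Nat.pair_unpair n).symm⟩
    induction y generalizing v with
    | zero =>
      rcases hL _ h with ht | ht | ht | ht | ht | ⟨r, hr, s, hs, ht⟩ | ⟨r, hr, s, hs, ht⟩ |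
        ⟨h0, r, hr, d', hd, ht⟩ | ⟨r, hr, s, hs, a, ha, ht⟩ | ⟨r, hr, ht⟩ <;>
        simp only [OracleCode.index] at ht <;> try omega
      · obtain ⟨rc, rn, rv⟩ := r
        obtain ⟨h1, h2, h3⟩ := ht
        dsimp only at h1
        obtain ⟨h5, h6⟩ :=
          Nat.pair_eq_pair.1 (show Nat.pair c.index d.index = Nat.pair rc d' by omega)
        simp only [Nat.unpair_pair] at h2 h3
        subst h2 h3 h5 h6
        exact (OracleCode.mem_eval_prec_iff (y := 0)).1.2 (ihc _ _ hr)
      · have := (Nat.pair_eq_pair.1 ht.2.2.1).2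
        omega
    | succ y ih =>
      rcases hL _ h with ht | ht | ht | ht | ht | ⟨r, hr, s, hs, ht⟩ | ⟨r, hr, s, hs, ht⟩ |
        ⟨h0, r, hr, d', hd, ht⟩ | ⟨r, hr, s, hs, a, ha, ht⟩ | ⟨r, hr, ht⟩ <;>
        simp only [OracleCode.index] at ht <;> try omega
      · simp at h0
      · obtain ⟨rc, rn, rv⟩ := r
        obtain ⟨sc, sn, sv⟩ := s
        obtain ⟨h1, h2, h3, h4, h5⟩ := ht
        dsimp only at h1
        obtain ⟨rm, ry, rfl⟩ : ∃ m y, rn = Nat.pair m y := ⟨_, _, (Nat.pair_unpair rn).symm⟩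
        obtain ⟨h6, h7⟩ :=
          Nat.pair_eq_pair.1 (show Nat.pair c.index d.index = Nat.pair a sc by omega)
        simp only [Nat.unpair_pair] at h2 h3 h4 h5
        obtain ⟨h8, h9⟩ := Nat.pair_eq_pair.1 h3
        obtain rfl : y = ry := by omega
        subst h2 h4 h5 h6 h7 h8
        exact (OracleCode.mem_eval_prec_iff).2.2 ⟨rv, ih _ hr, ihd _ _ hs⟩
  | rfind c ihc =>
    rcases hL _ h with ht | ht | ht | ht | ht | ⟨r, hr, s, hs, ht⟩ | ⟨r, hr, s, hs, ht⟩ |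
      ⟨h0, r, hr, d, hd, ht⟩ | ⟨r, hr, s, hs, a, ha, ht⟩ | ⟨r, hr, ht⟩ <;>
      simp only [OracleCode.index] at ht <;> try omega
    obtain ⟨rc, rn, rv⟩ := r
    obtain ⟨h1, h2, h3, h4⟩ := ht
    dsimp only at h1
    obtain rfl : c.index = rc := by omega
    simp only at h2 h3 h4
    subst h2 h3
    refine OracleCode.mem_eval_rfind_iff.2 ⟨ihc _ _ hr, fun m hm => ?_⟩
    obtain ⟨⟨sc, sn, sv⟩, hs, h5, h6, h7⟩ := h4 m hm
    simp only at h5 h6 h7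
    subst h5 h6
    exact ⟨sv, ihc _ _ hs, h7⟩

theorem exists_derivation {A : Set ℕ} (c : OracleCode) (n v : ℕ) (h : v ∈ c.eval A n) :
    ∃ L, IsDerivation L ∧ CorrectFor A L ∧ (c.index, n, v) ∈ L := by
  have base : ∀ t : ComputationFact, Justified [] t → (t.1 = 4 → t.2.2 ∈ oracleOf A t.2.1) →
      ∃ L, IsDerivation L ∧ CorrectFor A L ∧ t ∈ L := fun t h1 h2 =>
    ⟨[t], IsDerivation.cons (by simp [IsDerivation]) h1,
      CorrectFor.cons (by simp [CorrectFor]) h2, by simp⟩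
  -- A compound program never has index 4, so its fact imposes no new condition on the oracle.
  have step : ∀ L, IsDerivation L → CorrectFor A L → ∀ t : ComputationFact, Justified L t →
      t.1 ≠ 4 → ∃ L, IsDerivation L ∧ CorrectFor A L ∧ t ∈ L := fun L h1 h2 t h3 h4 =>
    ⟨t :: L, h1.cons h3, h2.cons fun h => absurd h h4, by simp⟩
  induction c generalizing n v with
  | zero => exact base _ (.inl ⟨rfl, by simpa [OracleCode.eval] using h⟩) (by simp [OracleCode.index])
  | succ =>
    exact base _ (.inr (.inl ⟨rfl, by simpa [OracleCode.eval] using h⟩)) (by simp [OracleCode.index])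
  | left =>
    exact base _ (.inr (.inr (.inl ⟨rfl, by simpa [OracleCode.eval] using h⟩)))
      (by simp [OracleCode.index])
  | right =>
    exact base _ (.inr (.inr (.inr (.inl ⟨rfl, by simpa [OracleCode.eval] using h⟩))))
      (by simp [OracleCode.index])
  | oracle => exact base _ (.inr (.inr (.inr (.inr (.inl rfl))))) fun _ => h
  | pair c d ihc ihd =>
    obtain ⟨x, hx, y, hy, rfl⟩ := OracleCode.mem_eval_pair_iff.1 h
    obtain ⟨L, hL, hL', hcL⟩ := ihc _ _ hx
    obtain ⟨M, hM, hM', hdM⟩ := ihd _ _ hy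
    refine step _ (hL.append hM) (hL'.append hM') _ ?_ (by simp only [OracleCode.index]; omega)
    exact .inr (.inr (.inr (.inr (.inr (.inl ⟨_, List.mem_append_left _ hcL, _,
      List.mem_append_right _ hdM, rfl, rfl, rfl, rfl⟩)))))
  | comp c d ihc ihd =>
    obtain ⟨x, hx, hy⟩ := OracleCode.mem_eval_comp_iff.1 h
    obtain ⟨L, hL, hL', hcL⟩ := ihc _ _ hy
    obtain ⟨M, hM, hM', hdM⟩ := ihd _ _ hx
    refine step _ (hL.append hM) (hL'.append hM') _ ?_ (by simp only [OracleCode.index]; omega)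
    exact .inr (.inr (.inr (.inr (.inr (.inr (.inl ⟨_, List.mem_append_left _ hcL, _,
      List.mem_append_right _ hdM, rfl, rfl, rfl, rfl⟩))))))
  | prec c d ihc ihd =>
    obtain ⟨m, y, rfl⟩ : ∃ m y, n = Nat.pair m y := ⟨_, _, (Nat.pair_unpair n).symm⟩
    have hc := Nat.left_le_pair c.index d.index
    have hd := Nat.right_le_pair c.index d.index
    induction y generalizing v with
    | zero =>
      obtain ⟨L, hL, hL', hcL⟩ := ihc _ _ ((OracleCode.mem_eval_prec_iff (y := 0)).1.1 h)
      refine step _ hL hL' _ ?_ (by simp only [OracleCode.index]; omega)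
      refine .inr (.inr (.inr (.inr (.inr (.inr (.inr (.inl ⟨by simp, _, hcL, d.index, ?_, rfl,
        by simp, rfl⟩)))))))
      simp only [OracleCode.index]; omega
    | succ y ih =>
      obtain ⟨i, hi, hv⟩ := (OracleCode.mem_eval_prec_iff).2.1 h
      obtain ⟨L, hL, hL', hcL⟩ := ih _ hi
      obtain ⟨M, hM, hM', hdM⟩ := ihd _ _ hv
      refine step _ (hL.append hM) (hL'.append hM') _ ?_ (by simp only [OracleCode.index]; omega)
      refine .inr (.inr (.inr (.inr (.inr (.inr (.inr (.inr (.inl ⟨_,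
        List.mem_append_left _ hcL, _, List.mem_append_right _ hdM, c.index, ?_, rfl, rfl,
        by simp, by simp, rfl⟩))))))))
      simp only [OracleCode.index]; omega
  | rfind c ihc =>
    obtain ⟨h0, hlt⟩ := OracleCode.mem_eval_rfind_iff.1 h
    obtain ⟨L, hL, hL', hcL⟩ := ihc _ _ h0
    -- Minimization depends on `v` further computations, whose derivations are concatenated one at a
    -- time.
    have key : ∀ k ≤ v, ∃ M, IsDerivation M ∧ CorrectFor A M ∧
        ∀ m < k, ∃ s ∈ M, s.1 = c.index ∧ s.2.1 = Nat.pair n m ∧ s.2.2 ≠ 0 := by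
      intro k
      induction k with
      | zero => exact fun _ => ⟨[], by simp [IsDerivation], by simp [CorrectFor], by simp⟩
      | succ k ih =>
        intro hk
        obtain ⟨M, hM, hM', hs⟩ := ih (by omega)
        obtain ⟨w, hw, hw0⟩ := hlt k (by omega)
        obtain ⟨N, hN, hN', hcN⟩ := ihc _ _ hw
        refine ⟨M ++ N, hM.append hN, hM'.append hN', fun m hm => ?_⟩
        rcases Nat.lt_succ_iff_lt_or_eq.1 hm with hm | rfl
        · obtain ⟨s, hsM, hs'⟩ := hs m hm
          exact ⟨s, List.mem_append_left _ hsM, hs'⟩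
        · exact ⟨_, List.mem_append_right _ hcN, rfl, rfl, hw0⟩
    obtain ⟨M, hM, hM', hs⟩ := key v le_rfl
    refine step _ (hL.append hM) (hL'.append hM') _ ?_ (by simp only [OracleCode.index]; omega)
    refine .inr (.inr (.inr (.inr (.inr (.inr (.inr (.inr (.inr ⟨_,
        List.mem_append_left _ hcL, rfl, rfl, rfl, fun m hm => ?_⟩))))))))
    obtain ⟨s, hsM, hs'⟩ := hs m hm
    exact ⟨s, List.mem_append_right _ hsM, hs'⟩

theorem OracleCode.mem_eval_iff {A : Set ℕ} {c : OracleCode} {n v : ℕ} :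
    v ∈ c.eval A n ↔ ∃ L, IsDerivation L ∧ CorrectFor A L ∧ (c.index, n, v) ∈ L :=
  ⟨exists_derivation c n v, fun ⟨_, h1, h2, h3⟩ => h1.sound h2 c n v h3⟩

/-- Facts in a derivation mention arbitrary numbers; surjectivity lets each of them be read as a
program. -/
theorem OracleCode.index_surjective : Function.Surjective OracleCode.index := by
  intro n
  induction n using Nat.strong_induction_on with
  | _ n ih =>
    by_cases h5 : n < 5
    · interval_cases n
      exacts [⟨.zero, rfl⟩, ⟨.succ, rfl⟩, ⟨.left, rfl⟩, ⟨.right, rfl⟩, ⟨.oracle, rfl⟩]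
    -- The remainder `r` names the constructor. The quotient `k` is a pair of indices for the three
    -- binary constructors and a single index for `rfind`, hence the three appeals to `ih`.
    obtain ⟨k, r, hr, hn⟩ : ∃ k r, r < 4 ∧ n = 4 * k + 5 + r :=
      ⟨(n - 5) / 4, (n - 5) % 4, by omega, by omega⟩
    obtain ⟨a, b, rfl⟩ : ∃ a b, k = Nat.pair a b := ⟨_, _, (Nat.pair_unpair k).symm⟩
    have ha := Nat.left_le_pair a b
    have hb := Nat.right_le_pair a b
    obtain ⟨c, hc⟩ := ih a (by omega)
    obtain ⟨d, hd⟩ := ih b (by omega)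
    obtain ⟨e, he⟩ := ih (Nat.pair a b) (by omega)
    interval_cases r
    · exact ⟨.pair c d, by simp only [index, hc, hd]; omega⟩
    · exact ⟨.comp c d, by simp only [index, hc, hd]; omega⟩
    · exact ⟨.prec c d, by simp only [index, hc, hd]; omega⟩
    · exact ⟨.rfind e, by simp only [index, he]; omega⟩

theorem PrimrecPred.exists_eq_some {α β : Type*} [Primcodable α] [Primcodable β]
    {f : α → Option β} {R : α → β → Prop} (hf : Primrec f)
    (hR : PrimrecPred fun p : α × β => R p.1 p.2) :
    PrimrecPred fun a => ∃ b, f a = some b ∧ R a b :=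
  (PrimrecPred.exists_mem (Primrec.optionToList.comp hf) hR).of_eq fun a => by simp

/-! ### Unbounded search relative to an oracle -/

section RelativeSearch

variable {α β σ : Type} [Primcodable α] [Primcodable β] [Primcodable σ]

theorem Nat.RecursiveIn.comp_total {O : Set (ℕ →. ℕ)} {f g : ℕ → ℕ}
    (hf : Nat.RecursiveIn O (fun n => Part.some (f n)))
    (hg : Nat.RecursiveIn O (fun n => Part.some (g n))) :
    Nat.RecursiveIn O (fun n => Part.some (f (g n))) :=
  (hf.comp hg).of_eq fun _ => Part.bind_some _ _

theorem Nat.RecursiveIn.pair_total {O : Set (ℕ →. ℕ)} {f g : ℕ → ℕ}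
    (hf : Nat.RecursiveIn O (fun n => Part.some (f n)))
    (hg : Nat.RecursiveIn O (fun n => Part.some (g n))) :
    Nat.RecursiveIn O (fun n => Part.some (Nat.pair (f n) (g n))) :=
  (hf.pair hg).of_eq fun n => by simp [Seq.seq]

theorem Primrec.nat_recursiveIn {O : Set (ℕ →. ℕ)} {f : ℕ → ℕ} (hf : Primrec f) :
    Nat.RecursiveIn O (fun n => Part.some (f n)) :=
  (Primrec.nat_iff.1 hf).recursiveIn

theorem RecursiveIn.map_primrec {O : Set (ℕ →. ℕ)} {f : α →. β} {g : β → σ}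
    (hf : RecursiveIn O f) (hg : Primrec g) : RecursiveIn O fun a => (f a).map g := by
  have h : Primrec fun n => ((decode (α := β) n).map fun b => encode (g b)).getD 0 :=
    Primrec.option_getD.comp (Primrec.option_map Primrec.decode
      ((Primrec.encode.comp hg).comp Primrec.snd).to₂) (Primrec.const 0)
  refine (Nat.RecursiveIn.comp (h.nat_recursiveIn) hf).of_eq fun n => ?_
  rcases hn : (decode (α := α) n) with _ | a
  · simp
  · ext v
    simp [eq_comm]

/-- The list of the first `n` values of the characteristic function of `A`. -/
noncomputable def oracleList (A : Set ℕ) (n : ℕ) : List ℕ :=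
  open Classical in (List.range n).map fun m => if m ∈ A then 1 else 0

@[simp]
theorem oracleList_length (A : Set ℕ) (n : ℕ) : (oracleList A n).length = n := by
  simp [oracleList]

theorem oracleList_getElem?_eq_some_iff {A : Set ℕ} {n m v : ℕ} :
    (oracleList A n)[m]? = some v ↔ m < n ∧ v ∈ oracleOf A m := by
  classical
  by_cases h : m < n
  · simp [oracleList, oracleOf, h, eq_comm]
  · simp [oracleList, h]

theorem oracleList_take {A : Set ℕ} {m n : ℕ} (h : m ≤ n) :
    (oracleList A n).take m = oracleList A m := by
  classical
  simp [oracleList, ← List.map_take, List.take_range, h]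

theorem recursiveIn_encode_oracleList (A : Set ℕ) :
    Nat.RecursiveIn {oracleOf A} (fun n => Part.some (encode (oracleList A n))) := by
  classical
  have hstep : Primrec fun m : ℕ => encode (((decode (α := List ℕ) m.unpair.1).getD []) ++
      [m.unpair.2]) :=
    Primrec.encode.comp (Primrec.list_concat.comp (Primrec.option_getD.comp
      (Primrec.decode.comp (Primrec.fst.comp Primrec.unpair)) (Primrec.const []))
      (Primrec.snd.comp Primrec.unpair))
  have hi : Primrec fun m : ℕ => m.unpair.2.unpair.2 :=
    Primrec.snd.comp (Primrec.unpair.comp (Primrec.snd.comp Primrec.unpair))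
  have hy : Primrec fun m : ℕ => m.unpair.2.unpair.1 :=
    Primrec.fst.comp (Primrec.unpair.comp (Primrec.snd.comp Primrec.unpair))
  have hO : Nat.RecursiveIn {oracleOf A} (fun n => Part.some (if n ∈ A then 1 else 0)) :=
    .oracle _ rfl
  -- Primitive recursion on the length appends one oracle value at each step; the parameter is a
  -- dummy, set to 0 below.
  have hrec := Nat.RecursiveIn.prec
    (((Primrec.const (encode ([] : List ℕ))).nat_recursiveIn (O := {oracleOf A})))
    (hstep.nat_recursiveIn.comp_total (hi.nat_recursiveIn.pair_total
      (hO.comp_total hy.nat_recursiveIn)))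
  have hp : Primrec fun n => Nat.pair 0 n := Primrec₂.natPair.comp (Primrec.const 0) Primrec.id
  refine (hrec.comp hp.nat_recursiveIn).of_eq fun n => ?_
  refine (Part.bind_some _ _).trans ?_
  simp only [Nat.unpair_pair]
  induction n with
  | zero => rfl
  | succ n ih =>
    simp only [ih]
    refine (Part.bind_some _ _).trans ?_
    simp [oracleList, List.range_succ]

/-- Unbounded search, with a primitive recursive test that reads a finite part of the oracle. -/
theorem exists_nat_search (A : Set ℕ) {R : α → ℕ → List ℕ → Prop}
    (hR : PrimrecPred fun p : α × ℕ × List ℕ => R p.1 p.2.1 p.2.2) :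
    ∃ f : α →. ℕ, RecursiveIn {oracleOf A} f ∧
      (∀ a, ∀ n ∈ f a, R a n (oracleList A n)) ∧
      ∀ a, (∃ n, R a n (oracleList A n)) → (f a).Dom := by
  classical
  have hT : PrimrecPred fun m : ℕ => ∃ p : α × ℕ × List ℕ, decode m = some p ∧
      R p.1 p.2.1 p.2.2 :=
    PrimrecPred.exists_eq_some (β := α × ℕ × List ℕ)
      (R := fun _ p => R p.1 p.2.1 p.2.2) Primrec.decode
      (hR.comp Primrec.snd)
  -- Zero signals success, as `rfind` looks for a zero.
  have hG : Primrec fun m : ℕ => if ∃ p : α × ℕ × List ℕ, decode m = some p ∧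
      R p.1 p.2.1 p.2.2 then 0 else 1 := Primrec.ite hT (Primrec.const 0) (Primrec.const 1)
  have hk : Primrec fun m : ℕ => m.unpair.1 := Primrec.fst.comp Primrec.unpair
  have hn : Primrec fun m : ℕ => m.unpair.2 := Primrec.snd.comp Primrec.unpair
  have hF := (hG.nat_recursiveIn (O := {oracleOf A})).comp_total
    (hk.nat_recursiveIn.pair_total (hn.nat_recursiveIn.pair_total
      ((recursiveIn_encode_oracleList A).comp_total hn.nat_recursiveIn)))
  refine ⟨fun a => Nat.rfind fun n => Part.some (decide (R a n (oracleList A n))), ?_, ?_, ?_⟩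
  · refine hF.rfind.of_eq fun k => ?_
    ext v
    refine Nat.mem_rfind.trans ?_
    rcases hk : (decode (α := α) k) with _ | a
    · simp [Encodable.decode_prod_val, hk]
    · have h : (v ∈ Nat.rfind fun n => Part.some (decide (R a n (oracleList A n)))) ↔ _ :=
        Nat.mem_rfind
      simp [Encodable.decode_prod_val, hk, h]
  · intro a n h
    simpa using (Nat.mem_rfind.1 h).1
  · rintro a ⟨n, h⟩
    exact Nat.rfind_dom.2 ⟨n, by simpa using h, fun _ => trivial⟩

/-- Unbounded search for a witness of any type, with a primitive recursive test that reads a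
finite part of the oracle. -/
theorem exists_search (A : Set ℕ) {R : α → β → List ℕ → Prop}
    (hR : PrimrecPred fun p : α × β × List ℕ => R p.1 p.2.1 p.2.2) :
    ∃ f : α →. β, RecursiveIn {oracleOf A} f ∧
      (∀ a, ∀ b ∈ f a, ∃ n, R a b (oracleList A n)) ∧
      ∀ a, (∃ b n, R a b (oracleList A n)) → (f a).Dom := by
  -- The number searched for codes both the witness and the length of oracle needed. The list
  -- supplied has the length of the whole code, so it is cut back to the coded length.
  have hR' : PrimrecPred fun p : α × ℕ × List ℕ => ∃ b : β, decode p.2.1.unpair.1 = some b ∧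
      R p.1 b (p.2.2.take p.2.1.unpair.2) := by
    refine PrimrecPred.exists_eq_some (α := α × ℕ × List ℕ)
      (R := fun p b => R p.1 b (p.2.2.take p.2.1.unpair.2))
      (Primrec.decode.comp (Primrec.fst.comp (Primrec.unpair.comp
        (Primrec.fst.comp Primrec.snd)))) (hR.comp (Primrec.pair
        (Primrec.fst.comp Primrec.fst) (Primrec.pair Primrec.snd (Primrec.list_take.comp ?_ ?_))))
    · exact Primrec.snd.comp (Primrec.unpair.comp (Primrec.fst.comp
        (Primrec.snd.comp Primrec.fst)))
    · exact Primrec.snd.comp (Primrec.snd.comp Primrec.fst)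
  obtain ⟨f, hf, hsound, hdom⟩ := exists_nat_search A (R := fun a n l =>
    ∃ b : β, decode n.unpair.1 = some b ∧ R a b (l.take n.unpair.2)) hR'
  have hd : ∀ a, ∀ n ∈ f a, ∃ b : β, decode n.unpair.1 = some b ∧
      R a b (oracleList A n.unpair.2) := by
    intro a n h
    obtain ⟨b, hb, h⟩ := hsound a n h
    rw [oracleList_take (Nat.unpair_right_le n)] at h
    exact ⟨b, hb, h⟩
  -- Decoding needs a default value in `β`; if there is none, the nowhere defined function serves.
  by_cases hβ : Nonempty β
  · obtain ⟨b₀⟩ := hβ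
    refine ⟨fun a => (f a).map fun n => (decode (α := β) n.unpair.1).getD b₀,
      hf.map_primrec (Primrec.option_getD.comp (Primrec.decode.comp
        (Primrec.fst.comp Primrec.unpair)) (Primrec.const b₀)), ?_, ?_⟩
    · intro a b h
      obtain ⟨n, hn, rfl⟩ := (Part.mem_map_iff _).1 h
      obtain ⟨b, hb, hR⟩ := hd a n hn
      exact ⟨_, by simpa [hb] using hR⟩
    · rintro a ⟨b, n, h⟩
      refine hdom a ⟨Nat.pair (encode b) n, b, by simp, ?_⟩
      rw [oracleList_take (Nat.unpair_right_le _)]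
      simpa using h
  · refine ⟨fun _ => Part.none, RecursiveIn.none, by simp, ?_⟩
    rintro a ⟨b, -⟩
    exact absurd ⟨b⟩ hβ

theorem isCEIn_of_exists (A : Set ℕ) {S : Set α} {R : α → β → List ℕ → Prop}
    (hR : PrimrecPred fun p : α × β × List ℕ => R p.1 p.2.1 p.2.2)
    (hS : ∀ a, a ∈ S ↔ ∃ b n, R a b (oracleList A n)) : IsCEIn A S := by
  obtain ⟨f, hf, hsound, hdom⟩ := exists_search A hR
  refine (hf.map_primrec (Primrec.const ())).of_eq fun a => ?_
  ext u
  simp only [Part.mem_map_iff, and_true, Part.mem_assert_iff, Part.mem_some_iff,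
    exists_prop, hS]
  exact ⟨fun ⟨b, hb⟩ => ⟨b, hsound a b hb⟩, fun h => Part.dom_iff_mem.1 (hdom a h)⟩

/-- The search is for the answer `b` itself: the correct answer, and only it, has a certificate. -/
theorem isComputableIn_of_forall (A : Set ℕ) {S : Set α} {R : α → Bool → List ℕ → Prop}
    (hR : PrimrecPred fun p : α × Bool × List ℕ => R p.1 p.2.1 p.2.2)
    (hS : ∀ a b, (∃ n, R a b (oracleList A n)) ↔ (b = true ↔ a ∈ S)) : IsComputableIn A S := by
  classical
  obtain ⟨f, hf, hsound, hdom⟩ := exists_search A hR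
  have h := hf.of_eq_tot (g := fun a => decide (a ∈ S)) fun a => by
    obtain ⟨b, hb⟩ := Part.dom_iff_mem.1 (hdom a
      ⟨decide (a ∈ S), (hS a (decide (a ∈ S))).2 (by simp)⟩)
    have := (hS a b).1 (hsound a b hb)
    rwa [show decide (a ∈ S) = b by rw [Bool.eq_iff_iff, this]; simp]
  exact h

end RelativeSearch

/-! ### Reductions to the halting problem -/

namespace OracleCode

/-- A program with the constant value `n`. -/
def const : ℕ → OracleCode
  | 0 => zero
  | n + 1 => comp succ (const n)

theorem eval_const (A : Set ℕ) (n m : ℕ) : (const n).eval A m = Part.some n := by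
  induction n with
  | zero => rfl
  | succ n ih =>
    change (const n).eval A m >>= _ = _
    rw [ih]
    exact Part.bind_some _ _

theorem primrec_index_const : Primrec fun n => (const n).index := by
  -- Here 1 is the index of `succ`, and 6 is the offset for `comp`.
  have h : Primrec₂ fun (_ i : ℕ) => 4 * Nat.pair 1 i + 6 :=
    Primrec.nat_add.comp (Primrec.nat_mul.comp (Primrec.const 4)
      (Primrec₂.natPair.comp (Primrec.const 1) Primrec.snd)) (Primrec.const 6)
  refine (Primrec.nat_rec₁ 0 h).of_eq fun n => ?_
  induction n with
  | zero => rfl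
  | succ n ih => simpa [const, index] using ih

end OracleCode

/-- A computably enumerable set is many-one reducible to the halting problem. -/
theorem exists_reduction_turingJump (A : Set ℕ) {α β : Type} [Primcodable α] [Primcodable β]
    {R : α → β → Prop} (hR : PrimrecPred fun p : α × β => R p.1 p.2) :
    ∃ h : α → ℕ, Primrec h ∧ ∀ a, h a ∈ turingJump A ↔ ∃ b, R a b := by
  obtain ⟨f, hf, hsound, hdom⟩ := exists_search A (R := fun a b (_ : List ℕ) => R a b)
    (hR.comp (Primrec.pair Primrec.fst (Primrec.fst.comp Primrec.snd)))
  obtain ⟨c, hc⟩ := (OracleCode.exists_eval_eq_iff A _).2 hf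
  -- The program ignores its input and searches for a witness for `a`, so it halts on its own index
  -- exactly when a witness exists.
  refine ⟨fun a => (OracleCode.comp c (OracleCode.const (encode a))).index, ?_, fun a => ?_⟩
  · exact Primrec.nat_add.comp (Primrec.nat_mul.comp (Primrec.const 4) (Primrec₂.natPair.comp
      (Primrec.const c.index) (OracleCode.primrec_index_const.comp Primrec.encode)))
      (Primrec.const 6)
  · have key : ∀ m, ((OracleCode.comp c (OracleCode.const (encode a))).eval A m) =
        (f a).map encode := by
      intro m
      change (OracleCode.const (encode a)).eval A m >>= c.eval A = _
      rw [OracleCode.eval_const, hc]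
      refine (Part.bind_some _ _).trans ?_
      simp
    have : (f a).Dom ↔ ∃ b, R a b :=
      ⟨fun h => ((hsound a _ (Part.get_mem h)).imp fun _ h => h).elim fun _ h => ⟨_, h⟩,
        fun ⟨b, hb⟩ => hdom a ⟨b, 0, hb⟩⟩
    rw [← this]
    constructor
    · rintro ⟨d, hd, h⟩
      rwa [OracleCode.index_injective hd, key] at h
    · intro h
      exact ⟨_, rfl, by rwa [key]⟩

/-! ### The tree of diagonally noncomputable functions -/

/-- The facts about the oracle in `L` can be read off from the list `l` of oracle values. -/
def ReadsFrom (l : List ℕ) (L : List ComputationFact) : Prop :=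
  ∀ t ∈ L, t.1 = 4 → l[t.2.1]? = some t.2.2

theorem primrecPred_readsFrom :
    PrimrecPred fun p : List ℕ × List ComputationFact => ReadsFrom p.1 p.2 := by
  refine PrimrecPred.forall_mem (α := List ℕ × List ComputationFact)
    (R := fun p t => t.1 = 4 → p.1[t.2.1]? = some t.2.2) Primrec.snd
    (.imp (.eq (Primrec.fst.comp Primrec.snd) (Primrec.const 4)) (.eq
      (Primrec.list_getElem?.comp (Primrec.fst.comp Primrec.fst) ?_) ?_))
  · exact Primrec.fst.comp (Primrec.snd.comp Primrec.snd)
  · exact Primrec.option_some.comp (Primrec.snd.comp (Primrec.snd.comp Primrec.snd))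

theorem ReadsFrom.mono {A : Set ℕ} {m n : ℕ} (h : m ≤ n) {L : List ComputationFact}
    (hL : ReadsFrom (oracleList A m) L) : ReadsFrom (oracleList A n) L := by
  intro t ht h4
  obtain ⟨h1, h2⟩ := oracleList_getElem?_eq_some_iff.1 (hL t ht h4)
  exact oracleList_getElem?_eq_some_iff.2 ⟨by omega, h2⟩

theorem ReadsFrom.correctFor {A : Set ℕ} {n : ℕ} {L : List ComputationFact}
    (hL : ReadsFrom (oracleList A n) L) : CorrectFor A L :=
  fun t ht h4 => (oracleList_getElem?_eq_some_iff.1 (hL t ht h4)).2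

/-- The use principle: a derivation consults only finitely many oracle values. -/
theorem CorrectFor.exists_readsFrom {A : Set ℕ} {L : List ComputationFact}
    (hL : CorrectFor A L) : ∃ n, ReadsFrom (oracleList A n) L := by
  induction L with
  | nil => exact ⟨0, by simp [ReadsFrom]⟩
  | cons t L ih =>
    obtain ⟨n, hn⟩ := ih fun s hs => hL s (List.mem_cons_of_mem _ hs)
    refine ⟨max n (t.2.1 + 1), fun s hs h4 => ?_⟩
    rcases List.mem_cons.1 hs with rfl | hs'
    · exact oracleList_getElem?_eq_some_iff.2 ⟨by omega, hL _ hs h4⟩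
    · exact hn.mono (le_max_left _ _) s hs' h4

/-- A derivation of code less than `|σ|`, with oracle values from `l`, shows that `σ` agrees
somewhere with the diagonal function `e ↦ Φ_e(e)`. -/
def MeetsDiagonal (σ : List Bool) (l : List ℕ) : Prop :=
  ∃ m < σ.length, ∃ L : List ComputationFact, decode m = some L ∧ (IsDerivation L ∧
    ReadsFrom l L ∧ ∃ t ∈ L, t.1 = t.2.1 ∧ ∃ b : Bool, σ[t.1]? = some b ∧ t.2.2 = encode b)

/-- The tree of the binary strings that are not yet seen to meet the diagonal function of `A`. -/
def diagonalTree (A : Set ℕ) : Set (List Bool) :=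
  {σ | ¬ MeetsDiagonal σ (oracleList A σ.length)}

theorem primrecPred_meetsDiagonal :
    PrimrecPred fun p : List Bool × List ℕ => MeetsDiagonal p.1 p.2 := by
  unfold MeetsDiagonal
  refine .exists_lt_of (Primrec.list_length.comp Primrec.fst) (.exists_eq_some
    (α := (List Bool × List ℕ) × ℕ) (β := List ComputationFact)
    (R := fun p L => IsDerivation L ∧ ReadsFrom p.1.2 L ∧ ∃ t ∈ L, t.1 = t.2.1 ∧
      ∃ b : Bool, p.1.1[t.1]? = some b ∧ t.2.2 = encode b) (Primrec.decode.comp Primrec.snd)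
    (.and (primrecPred_isDerivation.comp Primrec.snd) (.and (primrecPred_readsFrom.comp
      (Primrec.pair (Primrec.snd.comp (Primrec.fst.comp Primrec.fst)) Primrec.snd))
      (.exists_mem Primrec.snd (.and ?_ ?_)))))
  · exact .eq (Primrec.fst.comp Primrec.snd) (Primrec.fst.comp (Primrec.snd.comp Primrec.snd))
  · refine .exists_eq_some (α := (((List Bool × List ℕ) × ℕ) × List ComputationFact) ×
      ComputationFact) (R := fun p b => p.2.2.2 = encode b) (Primrec.list_getElem?.comp ?_
      (Primrec.fst.comp Primrec.snd)) (.eq ?_ (Primrec.encode.comp Primrec.snd))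
    · exact Primrec.fst.comp (Primrec.fst.comp (Primrec.fst.comp Primrec.fst))
    · exact Primrec.snd.comp (Primrec.snd.comp (Primrec.snd.comp Primrec.fst))

theorem isComputableIn_diagonalTree (A : Set ℕ) : IsComputableIn A (diagonalTree A) := by
  refine isComputableIn_of_forall A (R := fun σ b l => l.length = σ.length ∧
    ((b = true ∧ ¬ MeetsDiagonal σ l) ∨ (b = false ∧ MeetsDiagonal σ l))) ?_ ?_
  · have hσ : Primrec fun p : List Bool × Bool × List ℕ => p.1 := Primrec.fst
    have hb : Primrec fun p : List Bool × Bool × List ℕ => p.2.1 :=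
      Primrec.fst.comp Primrec.snd
    have hl : Primrec fun p : List Bool × Bool × List ℕ => p.2.2 :=
      Primrec.snd.comp Primrec.snd
    have hm := primrecPred_meetsDiagonal.comp (Primrec.pair hσ hl)
    exact .and (.eq (Primrec.list_length.comp hl) (Primrec.list_length.comp hσ))
      (.or (.and (.eq hb (Primrec.const true)) hm.not)
        (.and (.eq hb (Primrec.const false)) hm))
  · intro σ b
    simp only [oracleList_length, exists_eq_left, diagonalTree, Set.mem_ofPred_eq]
    cases b <;> simp

/-- The length of a string bounds both the code of the derivation and the part of the oracle it may
read, so an agreement seen by a string is seen by all its extensions. -/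
theorem isBinaryTree_diagonalTree (A : Set ℕ) : IsBinaryTree (diagonalTree A) := by
  rintro σ τ hστ hτ ⟨m, hm, L, hmL, hL, hl, t, ht, htt, b, hb, htb⟩
  have hlen := hστ.length_le
  refine hτ ⟨m, by omega, L, hmL, hL, hl.mono hlen, t, ht, htt, b, ?_, htb⟩
  obtain ⟨ρ, rfl⟩ := hστ
  obtain ⟨h1, -⟩ := List.getElem?_eq_some_iff.1 hb
  rwa [List.getElem?_append_left h1]

theorem isPathThrough_diagonalTree_iff {A : Set ℕ} {P : ℕ → Bool} :
    IsPathThrough P (diagonalTree A) ↔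
      ∀ c : OracleCode, encode (P c.index) ∉ c.eval A c.index := by
  constructor
  · intro hP c hc
    obtain ⟨L, hL, hA, hcL⟩ := OracleCode.mem_eval_iff.1 hc
    obtain ⟨n, hn⟩ := hA.exists_readsFrom
    -- The initial segment has to be long enough for the oracle use, for the code of the derivation,
    -- and to have a bit at position `c.index`.
    refine hP (max n (max (encode L + 1) (c.index + 1))) ⟨encode L, ?_, L, encodek L, hL, ?_,
      _, hcL, rfl, P c.index, ?_, rfl⟩
    · simp
    · exact hn.mono (by simp)
    · simp
  · rintro hP n ⟨m, hm, L, hmL, hL, hl, ⟨e, x, v⟩, ht, htt, b, hb, htb⟩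
    obtain ⟨c, rfl⟩ := OracleCode.index_surjective e
    obtain rfl : c.index = x := htt
    obtain rfl : v = encode b := htb
    obtain ⟨h1, h2⟩ := List.getElem?_eq_some_iff.1 hb
    obtain rfl : P c.index = b := by simpa using h2
    exact hP c (hL.sound hl.correctFor c _ _ ht)

theorem infinite_diagonalTree (A : Set ℕ) : (diagonalTree A).Infinite := by
  classical
  -- Taking the value 1 exactly where the diagonal function is 0 avoids it everywhere. The initial
  -- segments of this path are then infinitely many nodes.
  have hP : IsPathThrough (fun e => decide (∃ c : OracleCode, c.index = e ∧ 0 ∈ c.eval A e))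
      (diagonalTree A) := by
    refine isPathThrough_diagonalTree_iff.2 fun c h => ?_
    by_cases h0 : 0 ∈ c.eval A c.index
    · rw [decide_eq_true ⟨c, rfl, h0⟩] at h
      exact absurd (Part.mem_unique h h0) (by simp)
    · rw [decide_eq_false] at h
      · exact h0 h
      · rintro ⟨d, hd, h'⟩
        rw [OracleCode.index_injective hd] at h'
        exact h0 h'
  refine Set.infinite_of_injective_forall_mem (fun m n h => ?_) hP
  simpa using congrArg List.length h

/-! ### Effectiveness of the forcing and density of deciding conditions -/

namespace LockCondition

theorem primrec_columns : Primrec LockCondition.columns :=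
  Primrec.of_equiv (e := equivList)

theorem primrecPred_le : PrimrecPred fun p : LockCondition × LockCondition => p.1 ≤ p.2 := by
  -- Extension in terms of bounded quantifiers. A lock and a list lookup are both of type `Option
  -- Bool`, so for a locked column `t.1[x]? = s.2` says that the new bit is the locked one.
  have h : PrimrecPred fun p : LockCondition × LockCondition =>
      p.2.columns.length ≤ p.1.columns.length ∧ ∀ i < p.2.columns.length,
        ∃ s, p.2.columns[i]? = some s ∧ ∃ t, p.1.columns[i]? = some t ∧ (t.2 = s.2 ∧
          t.1.take s.1.length = s.1 ∧ ∀ x < t.1.length,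
            s.1.length ≤ x → (s.2 = none ∨ t.1[x]? = s.2)) := by
    have hq : Primrec fun p : LockCondition × LockCondition => p.1.columns :=
      primrec_columns.comp Primrec.fst
    have hp : Primrec fun p : LockCondition × LockCondition => p.2.columns :=
      primrec_columns.comp Primrec.snd
    refine .and (Primrec.nat_le.comp (Primrec.list_length.comp hp) (Primrec.list_length.comp hq))
      (.forall_lt_of (Primrec.list_length.comp hp) ?_)
    refine .exists_eq_some (α := (LockCondition × LockCondition) × ℕ) (β := List Bool × Lock)
      (R := fun p s => ∃ t, p.1.1.columns[p.2]? = some t ∧ (t.2 = s.2 ∧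
          t.1.take s.1.length = s.1 ∧ ∀ x < t.1.length,
            s.1.length ≤ x → (s.2 = none ∨ t.1[x]? = s.2)))
      (Primrec.list_getElem?.comp (hp.comp Primrec.fst) Primrec.snd) ?_
    refine .exists_eq_some (α := ((LockCondition × LockCondition) × ℕ) × (List Bool × Lock))
      (β := List Bool × Lock) (R := fun p t => t.2 = p.2.2 ∧
          t.1.take p.2.1.length = p.2.1 ∧ ∀ x < t.1.length,
            p.2.1.length ≤ x → (p.2.2 = none ∨ t.1[x]? = p.2.2))
      (Primrec.list_getElem?.comp (hq.comp (Primrec.fst.comp Primrec.fst))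
        (Primrec.snd.comp Primrec.fst)) ?_
    have hs1 : Primrec fun p : (((LockCondition × LockCondition) × ℕ) × (List Bool × Lock)) ×
      (List Bool × Lock) => p.1.2.1 := Primrec.fst.comp (Primrec.snd.comp Primrec.fst)
    have hs2 : Primrec fun p : (((LockCondition × LockCondition) × ℕ) × (List Bool × Lock)) ×
      (List Bool × Lock) => p.1.2.2 := Primrec.snd.comp (Primrec.snd.comp Primrec.fst)
    have ht1 : Primrec fun p : (((LockCondition × LockCondition) × ℕ) × (List Bool × Lock)) ×
      (List Bool × Lock) => p.2.1 := Primrec.fst.comp Primrec.snd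
    have ht2 : Primrec fun p : (((LockCondition × LockCondition) × ℕ) × (List Bool × Lock)) ×
      (List Bool × Lock) => p.2.2 := Primrec.snd.comp Primrec.snd
    exact .and (.eq ht2 hs2) (.and (.eq (Primrec.list_take.comp (Primrec.list_length.comp hs1)
      ht1) hs1) (.forall_lt_of (Primrec.list_length.comp ht1) (.imp
      (Primrec.nat_le.comp (Primrec.list_length.comp (hs1.comp Primrec.fst)) Primrec.snd)
      (.or (.eq (hs2.comp Primrec.fst) (Primrec.const none))
        (.eq (Primrec.list_getElem?.comp (ht1.comp Primrec.fst) Primrec.snd)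
          (hs2.comp Primrec.fst))))))
  refine h.of_eq fun ⟨q, p⟩ => and_congr_right fun hlen => ⟨fun h i σ a hσ => ?_, fun h i hi => ?_⟩
  · obtain ⟨hi, -⟩ := List.getElem?_eq_some_iff.1 hσ
    obtain ⟨s, hs, ⟨τ, a'⟩, ht, h1, h2, h3⟩ := h i hi
    obtain rfl : (σ, a) = s := Option.some.inj (hσ.symm.trans hs)
    obtain rfl : a' = a := h1
    refine ⟨τ, ht, List.prefix_iff_eq_take.2 h2.symm, fun b hb x hx hx' => ?_⟩
    rcases h3 x hx' hx with h3 | h3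
    · simp [hb] at h3
    · exact h3.trans hb
  · obtain ⟨τ, hτ, hστ, hb⟩ := h i _ _ (List.getElem?_eq_getElem hi)
    refine ⟨_, List.getElem?_eq_getElem hi, _, hτ, rfl, (List.prefix_iff_eq_take.1 hστ).symm, ?_⟩
    intro x hx hx'
    rcases ha : (p.columns[i]).2 with _ | b
    · exact .inl rfl
    · exact .inr (hb b ha x hx' hx)

/-- The value at `m` of the characteristic function of `R ⊕ f`, if `q` decides it. -/
def decidedBit (q : LockCondition) (m : ℕ) : Option ℕ :=
  q.columns[(m / 2).unpair.1]?.bind fun s =>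
    if m % 2 = 0 then s.1[(m / 2).unpair.2]?.map encode
    else some (if encode s.2 = (m / 2).unpair.2 then 1 else 0)

theorem primrec_decidedBit :
    Primrec fun p : LockCondition × ℕ => p.1.decidedBit p.2 := by
  have hm : Primrec fun p : LockCondition × ℕ => (p.2 / 2).unpair :=
    Primrec.unpair.comp (Primrec.nat_div.comp Primrec.snd (Primrec.const 2))
  have hx : Primrec fun p : (LockCondition × ℕ) × (List Bool × Lock) => (p.1.2 / 2).unpair.2 :=
    Primrec.snd.comp (hm.comp Primrec.fst)
  have hs : Primrec fun p : (LockCondition × ℕ) × (List Bool × Lock) => p.2 := Primrec.snd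
  refine Primrec.option_bind (Primrec.list_getElem?.comp (primrec_columns.comp Primrec.fst)
    (Primrec.fst.comp hm)) (Primrec₂.mk ?_)
  refine Primrec.ite (.eq (Primrec.nat_mod.comp (Primrec.snd.comp Primrec.fst) (Primrec.const 2))
    (Primrec.const 0)) ?_ ?_
  · exact Primrec.option_map (Primrec.list_getElem?.comp (Primrec.fst.comp hs) hx)
      (Primrec.encode.comp Primrec.snd).to₂
  · exact Primrec.option_some.comp (Primrec.ite
      (.eq (Primrec.encode.comp (Primrec.snd.comp hs)) hx) (Primrec.const 1) (Primrec.const 0))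

/-- Extensions only append bits to a column and never change its lock. So a condition having column
`i` settles every question about `f(i)`, negative answers included. -/
theorem decidedBit_mono {p q : LockCondition} (h : q ≤ p) {m v : ℕ}
    (hp : p.decidedBit m = some v) : q.decidedBit m = some v := by
  obtain ⟨⟨σ, a⟩, hσ, hv⟩ := Option.bind_eq_some_iff.1 hp
  obtain ⟨τ, hτ, ⟨ρ, rfl⟩, -⟩ := h.2 _ σ a hσ
  refine Option.bind_eq_some_iff.2 ⟨_, hτ, ?_⟩
  by_cases hm : m % 2 = 0 <;> simp only [hm, if_true, if_false] at hv ⊢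
  · obtain ⟨b, hb, rfl⟩ := Option.map_eq_some_iff.1 hv
    refine Option.map_eq_some_iff.2 ⟨b, ?_, rfl⟩
    obtain ⟨h1, -⟩ := List.getElem?_eq_some_iff.1 hb
    rwa [List.getElem?_append_left h1]
  · exact hv

theorem decidedBit_eq_zero_or_one {p : LockCondition} {m v : ℕ}
    (hp : p.decidedBit m = some v) : v = 0 ∨ v = 1 := by
  obtain ⟨⟨σ, a⟩, hσ, hv⟩ := Option.bind_eq_some_iff.1 hp
  split_ifs at hv
  · obtain ⟨b, -, rfl⟩ := Option.map_eq_some_iff.1 hv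
    cases b <;> simp
  · simp at hv; exact .inr hv.symm
  · simp at hv; exact .inl hv.symm

theorem exists_le_decidedBit (p : LockCondition) (m : ℕ) :
    ∃ q ≤ p, ∃ v, q.decidedBit m = some v := by
  -- After the addition of `m + 1` empty unlocked columns, every column is lengthened by `m + 1`
  -- copies of its locked bit, or of `false` if unlocked. This is long enough, as both components of
  -- the pair coded by `m / 2` are at most `m`.
  set pad : List Bool × Lock → List Bool × Lock := fun s =>
    (s.1 ++ List.replicate (m + 1) (s.2.getD false), s.2) with hpad
  set q : LockCondition := ⟨(p.columns ++ List.replicate (m + 1) ([], none)).map pad⟩ with hq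
  refine ⟨q, ⟨by simp [hq], fun i σ a hσ => ?_⟩, ?_⟩
  · obtain ⟨hi, -⟩ := List.getElem?_eq_some_iff.1 hσ
    refine ⟨σ ++ List.replicate (m + 1) (a.getD false), ?_, List.prefix_append _ _, ?_⟩
    · simp only [hq, List.getElem?_map, List.getElem?_append_left hi, hσ, Option.map_some, hpad]
    · rintro b rfl x hx hx'
      rw [List.getElem?_append_right hx]
      simp only [List.length_append, List.length_replicate] at hx'
      simp [List.getElem?_replicate]
      omega
  · have h2 : m / 2 ≤ m := Nat.div_le_self _ _
    have h3 := Nat.unpair_left_le (m / 2)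
    have h4 := Nat.unpair_right_le (m / 2)
    have hi : (m / 2).unpair.1 < (p.columns ++ List.replicate (m + 1) ([], none)).length := by
      simp; omega
    have hcol : q.columns[(m / 2).unpair.1]? = some
        (pad (p.columns ++ List.replicate (m + 1) ([], none))[(m / 2).unpair.1]) := by
      simp only [hq, List.getElem?_map, List.getElem?_eq_getElem hi, Option.map_some]
    simp only [decidedBit, hcol, Option.bind_some]
    split_ifs
    · have hlen : (m / 2).unpair.2 < (pad (p.columns ++ List.replicate (m + 1)
          ([], none))[(m / 2).unpair.1]).1.length := by
        simp [hpad]; omega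
      exact ⟨_, by rw [List.getElem?_eq_getElem hlen]; rfl⟩
    · exact ⟨_, rfl⟩
    · exact ⟨_, rfl⟩

end LockCondition

/-! ### The generic oracle and the conditions that decide it -/

/-- The set `R ⊕ f` determined by a filter. -/
abbrev genericJoin (G : Order.PFilter LockCondition) : Set ℕ :=
  turingJoin (genericSequence G) (genericLocks G)

theorem mem_genericJoin_iff {G : Order.PFilter LockCondition} {m : ℕ} :
    m ∈ genericJoin G ↔ ∃ p ∈ G, p.decidedBit m = some 1 := by
  have h2 : ∀ k, 2 * k / 2 = k := fun k => by omega
  have h3 : ∀ k, (2 * k + 1) / 2 = k := fun k => by omega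
  obtain ⟨k, rfl | rfl⟩ := Nat.even_or_odd' m
  · have : 2 * k ∈ genericJoin G ↔ k ∈ genericSequence G := by
      simp only [turingJoin, Set.mem_union, Set.mem_image]
      constructor
      · rintro (⟨n, hn, h⟩ | ⟨n, hn, h⟩)
        · rwa [show k = n by omega]
        · omega
      · exact fun h => .inl ⟨k, h, rfl⟩
    rw [this]
    refine exists_congr fun p => and_congr_right fun hp => ?_
    simp only [LockCondition.decidedBit, h2, Option.bind_eq_some_iff, Nat.mul_mod_right, if_true,
      Option.map_eq_some_iff, Prod.exists]
    refine exists_congr fun σ => exists_congr fun a => and_congr_right fun _ => ?_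
    constructor
    · exact fun h => ⟨true, h, rfl⟩
    · rintro ⟨b, hb, h⟩
      cases b
      · simp at h
      · exact hb
  · have : 2 * k + 1 ∈ genericJoin G ↔ k ∈ genericLocks G := by
      simp only [turingJoin, Set.mem_union, Set.mem_image]
      constructor
      · rintro (⟨n, hn, h⟩ | ⟨n, hn, h⟩)
        · omega
        · rwa [show k = n by omega]
      · exact fun h => .inr ⟨k, h, rfl⟩
    rw [this]
    simp only [LockCondition.decidedBit, h3, Option.bind_eq_some_iff,
      show (2 * k + 1) % 2 = 1 by omega, one_ne_zero, if_false, Prod.exists, Option.some.injEq]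
    constructor
    · rintro ⟨⟨i, a⟩, ⟨p, hp, σ, hσ⟩, rfl⟩
      refine ⟨p, hp, σ, a, ?_, ?_⟩ <;> simp [Encodable.encode_prod_val]
      exact hσ
    · rintro ⟨p, hp, σ, a, hσ, h⟩
      refine ⟨(k.unpair.1, a), ⟨p, hp, σ, hσ⟩, ?_⟩
      have ha : encode a = k.unpair.2 := by
        by_contra h'
        simp [h'] at h
      rw [Encodable.encode_prod_val]
      simp [ha]

theorem Order.PFilter.exists_le_le {P : Type*} [Preorder P] (G : Order.PFilter P) {p q : P}
    (hp : p ∈ G) (hq : q ∈ G) : ∃ r ∈ G, r ≤ p ∧ r ≤ q := by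
  obtain ⟨r, hr, h1, h2⟩ := G.directed p hp q hq
  exact ⟨r, hr, h1, h2⟩

/-- Finitely many facts, each secured by some member of the filter and preserved under extension,
are secured by one member. -/
theorem Order.PFilter.exists_forall_mem_list {P τ : Type*} [Preorder P] (G : Order.PFilter P)
    {R : P → τ → Prop} (hR : ∀ p q t, q ≤ p → R p t → R q t) (L : List τ)
    (h : ∀ t ∈ L, ∃ p ∈ G, R p t) : ∃ p ∈ G, ∀ t ∈ L, R p t := by
  induction L with
  | nil =>
    obtain ⟨p, hp⟩ := G.nonempty
    exact ⟨p, hp, by simp⟩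
  | cons t L ih =>
    obtain ⟨p, hp, hpt⟩ := h t (by simp)
    obtain ⟨q, hq, hqL⟩ := ih fun s hs => h s (List.mem_cons_of_mem _ hs)
    obtain ⟨r, hr, hrp, hrq⟩ := G.exists_le_le hp hq
    refine ⟨r, hr, fun s hs => ?_⟩
    rcases List.mem_cons.1 hs with rfl | hs
    · exact hR p r _ hrp hpt
    · exact hR q r _ hrq (hqL s hs)

/-- Members of a filter are compatible, so their decisions cannot conflict; no genericity is needed
in this direction. -/
theorem mem_oracleOf_genericJoin_of_decidedBit {G : Order.PFilter LockCondition}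
    {q : LockCondition} (hq : q ∈ G) {m v : ℕ} (h : q.decidedBit m = some v) :
    v ∈ oracleOf (genericJoin G) m := by
  rcases LockCondition.decidedBit_eq_zero_or_one h with rfl | rfl
  · refine oracleOf_mem_iff.2 (.inr ⟨rfl, fun hm => ?_⟩)
    obtain ⟨p, hp, hpm⟩ := mem_genericJoin_iff.1 hm
    obtain ⟨r, -, hrp, hrq⟩ := G.exists_le_le hp hq
    have h0 := LockCondition.decidedBit_mono hrq h
    rw [LockCondition.decidedBit_mono hrp hpm] at h0
    simp at h0
  · exact oracleOf_mem_iff.2 (.inl ⟨rfl, mem_genericJoin_iff.2 ⟨q, hq, h⟩⟩)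

theorem IsNGeneric.mem_oracleOf_genericJoin_iff {G : Order.PFilter LockCondition}
    (hG : IsNGeneric 2 G) {m v : ℕ} :
    v ∈ oracleOf (genericJoin G) m ↔ ∃ q ∈ G, q.decidedBit m = some v := by
  refine ⟨fun hv => ?_, fun ⟨q, hq, h⟩ => mem_oracleOf_genericJoin_of_decidedBit hq h⟩
  have hR : PrimrecPred fun p : LockCondition × ℕ × List ℕ =>
      p.1.decidedBit m = some p.2.1 :=
    .eq (LockCondition.primrec_decidedBit.comp (Primrec.pair Primrec.fst (Primrec.const m)))
      (Primrec.option_some.comp (Primrec.fst.comp Primrec.snd))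
  -- This set is in fact c.e.; it is presented as $\Sigma^0_2$ so that 2-genericity applies
  -- directly. Its density rules out the avoiding case.
  have hW : IsSigmaZero 2 {q : LockCondition | ∃ w, q.decidedBit m = some w} :=
    isCEIn_of_exists (turingJump ∅) (R := fun q w _ => q.decidedBit m = some w) hR
      fun q => by simp
  rcases hG _ hW with ⟨q, hq, w, hw⟩ | ⟨p, -, hp⟩
  · rw [Part.mem_unique hv (mem_oracleOf_genericJoin_of_decidedBit hq hw)]
    exact ⟨q, hq, hw⟩
  · obtain ⟨q, hqp, hq⟩ := p.exists_le_decidedBit m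
    exact absurd hq (hp q hqp)

/-! ### Forcing values of the jump -/

/-- The facts about the oracle `R ⊕ f` in `L` are decided by `q`. -/
def DecidesFacts (q : LockCondition) (L : List ComputationFact) : Prop :=
  ∀ t ∈ L, t.1 = 4 → q.decidedBit t.2.1 = some t.2.2

/-- The derivation `L` shows that every generic filter containing `q` has `j ∈ (R ⊕ f)'`. -/
def WitnessesJump (q : LockCondition) (j : ℕ) (L : List ComputationFact) : Prop :=
  IsDerivation L ∧ (∃ t ∈ L, t.1 = j ∧ t.2.1 = j) ∧ DecidesFacts q L

/-- The condition `q` forces the value of the characteristic function of `(R ⊕ f)'` at `j`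
to be `v`. -/
def ForcesJumpValue (q : LockCondition) (j v : ℕ) : Prop :=
  (v = 1 ∧ ∃ L, WitnessesJump q j L) ∨ (v = 0 ∧ ∀ r ≤ q, ∀ L, ¬ WitnessesJump r j L)

/-- The condition `q` forces the facts about the oracle `(R ⊕ f)'` in `L`. -/
def ForcesFacts (q : LockCondition) (L : List ComputationFact) : Prop :=
  ∀ t ∈ L, t.1 = 4 → ForcesJumpValue q t.2.1 t.2.2

theorem primrecPred_witnessesJump :
    PrimrecPred fun p : (LockCondition × ℕ) × List ComputationFact =>
      WitnessesJump p.1.1 p.1.2 p.2 := by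
  have ht1 : Primrec fun p : ((LockCondition × ℕ) × List ComputationFact) × ComputationFact =>
    p.2.1 := Primrec.fst.comp Primrec.snd
  have ht2 : Primrec fun p : ((LockCondition × ℕ) × List ComputationFact) × ComputationFact =>
    p.2.2.1 := Primrec.fst.comp (Primrec.snd.comp Primrec.snd)
  have ht3 : Primrec fun p : ((LockCondition × ℕ) × List ComputationFact) × ComputationFact =>
    p.2.2.2 := Primrec.snd.comp (Primrec.snd.comp Primrec.snd)
  have hj : Primrec fun p : ((LockCondition × ℕ) × List ComputationFact) × ComputationFact =>
    p.1.1.2 := Primrec.snd.comp (Primrec.fst.comp Primrec.fst)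
  have hq : Primrec fun p : ((LockCondition × ℕ) × List ComputationFact) × ComputationFact =>
    p.1.1.1 := Primrec.fst.comp (Primrec.fst.comp Primrec.fst)
  exact .and (primrecPred_isDerivation.comp Primrec.snd)
    (.and (.exists_mem Primrec.snd (.and (.eq ht1 hj) (.eq ht2 hj)))
      (.forall_mem Primrec.snd (.imp (.eq ht1 (Primrec.const 4))
        (.eq (LockCondition.primrec_decidedBit.comp (Primrec.pair hq ht2))
          (Primrec.option_some.comp ht3)))))

theorem WitnessesJump.mono {p q : LockCondition} (h : q ≤ p) {j : ℕ} {L : List ComputationFact}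
    (hL : WitnessesJump p j L) : WitnessesJump q j L :=
  ⟨hL.1, hL.2.1, fun t ht h4 => LockCondition.decidedBit_mono h (hL.2.2 t ht h4)⟩

theorem ForcesJumpValue.mono {p q : LockCondition} (h : q ≤ p) {j v : ℕ}
    (hp : ForcesJumpValue p j v) : ForcesJumpValue q j v := by
  rcases hp with ⟨hv, L, hL⟩ | ⟨hv, hL⟩
  · exact .inl ⟨hv, L, hL.mono h⟩
  · exact .inr ⟨hv, fun r hr => hL r (hr.trans h)⟩

/-- Truth lemma for halting: a computation uses finitely many bits of $R \oplus f$, and a single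
member of the filter decides them all. -/
theorem IsNGeneric.mem_turingJump_iff {G : Order.PFilter LockCondition} (hG : IsNGeneric 2 G)
    {j : ℕ} : j ∈ turingJump (genericJoin G) ↔ ∃ q ∈ G, ∃ L, WitnessesJump q j L := by
  constructor
  · rintro ⟨c, rfl, hc⟩
    obtain ⟨v, hv⟩ := Part.dom_iff_mem.1 hc
    obtain ⟨L, hL, hA, hcL⟩ := OracleCode.mem_eval_iff.1 hv
    obtain ⟨q, hq, hqL⟩ := G.exists_forall_mem_list
      (R := fun q (t : ComputationFact) => t.1 = 4 → q.decidedBit t.2.1 = some t.2.2)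
      (fun p q t hqp h h4 => LockCondition.decidedBit_mono hqp (h h4)) L fun t ht => by
        by_cases h4 : t.1 = 4
        · obtain ⟨q, hq, h⟩ := hG.mem_oracleOf_genericJoin_iff.1 (hA t ht h4)
          exact ⟨q, hq, fun _ => h⟩
        · obtain ⟨q, hq⟩ := G.nonempty
          exact ⟨q, hq, fun h => absurd h h4⟩
    exact ⟨q, hq, L, hL, ⟨_, hcL, rfl, rfl⟩, hqL⟩
  · rintro ⟨q, hq, L, hL, ⟨⟨c', n, v⟩, ht, rfl, h⟩, hqL⟩
    obtain ⟨c, rfl⟩ := OracleCode.index_surjective c'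
    obtain rfl : n = c.index := h
    exact ⟨c, rfl, Part.dom_iff_mem.2 ⟨v, hL.sound (fun t ht h4 =>
      mem_oracleOf_genericJoin_of_decidedBit hq (hqL t ht h4)) c _ _ ht⟩⟩

/-- For a value 0, the filter cannot meet the set of conditions that witness halting, so by
genericity it contains a condition with no extension in that set. -/
theorem IsNGeneric.mem_oracleOf_turingJump_iff {G : Order.PFilter LockCondition}
    (hG : IsNGeneric 2 G) {j v : ℕ} :
    v ∈ oracleOf (turingJump (genericJoin G)) j ↔ ∃ q ∈ G, ForcesJumpValue q j v := by
  rw [oracleOf_mem_iff, hG.mem_turingJump_iff]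
  constructor
  · rintro (⟨hv, q, hq, h⟩ | ⟨hv, h⟩)
    · exact ⟨q, hq, .inl ⟨hv, h⟩⟩
    · have hW : IsSigmaZero 2 {q : LockCondition | ∃ L, WitnessesJump q j L} := by
        refine isCEIn_of_exists (turingJump ∅) (R := fun q L _ => WitnessesJump q j L)
          (primrecPred_witnessesJump.comp (f := fun p : LockCondition × List ComputationFact ×
            List ℕ => ((p.1, j), p.2.1)) (Primrec.pair (Primrec.pair Primrec.fst (Primrec.const j))
            (Primrec.fst.comp Primrec.snd))) fun q => by simp
      rcases hG _ hW with ⟨q, hq, hqL⟩ | ⟨q, hq, hqL⟩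
      · exact absurd ⟨q, hq, hqL⟩ h
      · exact ⟨q, hq, .inr ⟨hv, fun r hr L hL => hqL r hr ⟨L, hL⟩⟩⟩
  · rintro ⟨q, hq, ⟨hv, h⟩ | ⟨hv, h⟩⟩
    · exact .inl ⟨hv, q, hq, h⟩
    · refine .inr ⟨hv, fun ⟨p, hp, L, hL⟩ => ?_⟩
      obtain ⟨r, -, hrp, hrq⟩ := G.exists_le_le hp hq
      exact h r hrq L (hL.mono hrp)

theorem IsNGeneric.correctFor_turingJump_iff {G : Order.PFilter LockCondition}
    (hG : IsNGeneric 2 G) {L : List ComputationFact} :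
    CorrectFor (turingJump (genericJoin G)) L ↔ ∃ q ∈ G, ForcesFacts q L := by
  constructor
  · intro hL
    refine G.exists_forall_mem_list
      (R := fun q (t : ComputationFact) => t.1 = 4 → ForcesJumpValue q t.2.1 t.2.2)
      (fun p q t hqp h h4 => (h h4).mono hqp) L fun t ht => ?_
    by_cases h4 : t.1 = 4
    · obtain ⟨q, hq, h⟩ := hG.mem_oracleOf_turingJump_iff.1 (hL t ht h4)
      exact ⟨q, hq, fun _ => h⟩
    · obtain ⟨q, hq⟩ := G.nonempty
      exact ⟨q, hq, fun h => absurd h h4⟩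
  · rintro ⟨q, hq, h⟩ t ht h4
    exact hG.mem_oracleOf_turingJump_iff.2 ⟨q, hq, h t ht h4⟩

/-- Forcing facts about `(R ⊕ f)'` is decidable from `∅'`. -/
theorem exists_primrec_forcesFacts :
    ∃ R : List ℕ → LockCondition → List ComputationFact → Prop,
      (PrimrecPred fun p : List ℕ × LockCondition × List ComputationFact =>
        R p.1 p.2.1 p.2.2) ∧ ∀ q L,
      (∀ n, R (oracleList (turingJump ∅) n) q L → ForcesFacts q L) ∧
      (ForcesFacts q L → ∃ m, ∀ n ≥ m, R (oracleList (turingJump ∅) n) q L) := by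
  -- Two queries to $\emptyset'$ settle a jump value: `f` asks whether the condition itself carries
  -- a witness of halting, `g` whether some extension does.
  obtain ⟨f, hf, hfS⟩ := exists_reduction_turingJump ∅
    (R := fun (p : LockCondition × ℕ) L => WitnessesJump p.1 p.2 L) primrecPred_witnessesJump
  obtain ⟨g, hg, hgS⟩ := exists_reduction_turingJump ∅
    (R := fun (p : LockCondition × ℕ) (s : LockCondition × List ComputationFact) =>
      s.1 ≤ p.1 ∧ WitnessesJump s.1 p.2 s.2) (.and
    (LockCondition.primrecPred_le.comp (Primrec.pair (Primrec.fst.comp Primrec.snd)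
      (Primrec.fst.comp Primrec.fst)))
    (primrecPred_witnessesJump.comp
      (f := fun p : (LockCondition × ℕ) × (LockCondition × List ComputationFact) =>
        ((p.2.1, p.1.2), p.2.2)) (Primrec.pair (Primrec.pair (Primrec.fst.comp Primrec.snd)
      (Primrec.snd.comp Primrec.fst)) (Primrec.snd.comp Primrec.snd))))
  have hforce : ∀ q j v, ForcesJumpValue q j v ↔
      (v = 1 ∧ 1 ∈ oracleOf (turingJump ∅) (f (q, j))) ∨
      (v = 0 ∧ 0 ∈ oracleOf (turingJump ∅) (g (q, j))) := by
    intro q j v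
    simp [ForcesJumpValue, oracleOf_mem_iff, hfS, hgS]
  -- A lookup beyond the end of the oracle list is `none` and fails the test. Hence success is sound
  -- at every length and persists from some length on, which allows a common length with other
  -- oracle uses.
  refine ⟨fun l q L => ∀ t ∈ L, t.1 = 4 → (t.2.2 = 1 ∧ l[f (q, t.2.1)]? = some 1) ∨
    (t.2.2 = 0 ∧ l[g (q, t.2.1)]? = some 0), ?_, fun q L => ⟨fun n h t ht h4 => ?_, fun h => ?_⟩⟩
  · have hl : Primrec fun p : (List ℕ × LockCondition × List ComputationFact) ×
      ComputationFact => p.1.1 := Primrec.fst.comp Primrec.fst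
    have ht1 : Primrec fun p : (List ℕ × LockCondition × List ComputationFact) ×
      ComputationFact => p.2.1 := Primrec.fst.comp Primrec.snd
    have hqt : Primrec fun p : (List ℕ × LockCondition × List ComputationFact) ×
      ComputationFact => (p.1.2.1, p.2.2.1) :=
      Primrec.pair (Primrec.fst.comp (Primrec.snd.comp Primrec.fst))
        (Primrec.fst.comp (Primrec.snd.comp Primrec.snd))
    have ht3 : Primrec fun p : (List ℕ × LockCondition × List ComputationFact) ×
      ComputationFact => p.2.2.2 := Primrec.snd.comp (Primrec.snd.comp Primrec.snd)
    exact .forall_mem (Primrec.snd.comp Primrec.snd) (.imp (.eq ht1 (Primrec.const 4))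
      (.or (.and (.eq ht3 (Primrec.const 1)) (.eq (Primrec.list_getElem?.comp hl (hf.comp hqt))
        (Primrec.const (some 1)))) (.and (.eq ht3 (Primrec.const 0))
        (.eq (Primrec.list_getElem?.comp hl (hg.comp hqt)) (Primrec.const (some 0))))))
  · refine (hforce _ _ _).2 ((h t ht h4).imp ?_ ?_) <;>
      exact And.imp_right fun h => (oracleList_getElem?_eq_some_iff.1 h).2
  · induction L with
    | nil => exact ⟨0, by simp⟩
    | cons t L ih =>
      obtain ⟨m, hm⟩ := ih fun s hs => h s (List.mem_cons_of_mem _ hs)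
      refine ⟨max m (max (f (q, t.2.1) + 1) (g (q, t.2.1) + 1)), fun n hn s hs h4 => ?_⟩
      rcases List.mem_cons.1 hs with rfl | hs'
      · refine ((hforce _ _ _).1 (h s hs h4)).imp ?_ ?_ <;>
          exact And.imp_right fun h => oracleList_getElem?_eq_some_iff.2 ⟨by omega, h⟩
      · exact hm n (by omega) s hs' h4

/-! ### Diagonalization against functions computable in the jump -/

/-- The conditions that force the `e`-th function computable in `(R ⊕ f)'` to meet the diagonal
function of `∅'`. -/
def forcesDiagonal (e : ℕ) : Set LockCondition :=
  {q | ∃ L, IsDerivation L ∧ ForcesFacts q L ∧ ∃ (c : OracleCode) (v : ℕ),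
    (e, c.index, v) ∈ L ∧ v ∈ c.eval (turingJump ∅) c.index}

theorem isSigmaZero_forcesDiagonal (e : ℕ) : IsSigmaZero 2 (forcesDiagonal e) := by
  obtain ⟨R, hR, hRS⟩ := exists_primrec_forcesFacts
  -- The witness has one derivation from the forced facts about $(R \oplus f)'$, a second one from
  -- $\emptyset'$, and the input and value they share.
  refine isCEIn_of_exists (turingJump ∅) (β := (List ComputationFact × List ComputationFact) ×
      (ℕ × ℕ))
    (R := fun q b l => (IsDerivation b.1.1 ∧ R l q b.1.1 ∧ (e, b.2.1, b.2.2) ∈ b.1.1) ∧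
      (IsDerivation b.1.2 ∧ ReadsFrom l b.1.2 ∧ (b.2.1, b.2.1, b.2.2) ∈ b.1.2)) ?_ fun q => ?_
  · have hL : Primrec fun p : LockCondition × ((List ComputationFact × List ComputationFact) ×
      (ℕ × ℕ)) × List ℕ => p.2.1.1.1 :=
      Primrec.fst.comp (Primrec.fst.comp (Primrec.fst.comp Primrec.snd))
    have hM : Primrec fun p : LockCondition × ((List ComputationFact × List ComputationFact) ×
      (ℕ × ℕ)) × List ℕ => p.2.1.1.2 :=
      Primrec.snd.comp (Primrec.fst.comp (Primrec.fst.comp Primrec.snd))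
    have hx : Primrec fun p : LockCondition × ((List ComputationFact × List ComputationFact) ×
      (ℕ × ℕ)) × List ℕ => p.2.1.2.1 :=
      Primrec.fst.comp (Primrec.snd.comp (Primrec.fst.comp Primrec.snd))
    have hv : Primrec fun p : LockCondition × ((List ComputationFact × List ComputationFact) ×
      (ℕ × ℕ)) × List ℕ => p.2.1.2.2 :=
      Primrec.snd.comp (Primrec.snd.comp (Primrec.fst.comp Primrec.snd))
    have hl : Primrec fun p : LockCondition × ((List ComputationFact × List ComputationFact) ×
      (ℕ × ℕ)) × List ℕ => p.2.2 := Primrec.snd.comp Primrec.snd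
    exact .and (.and (primrecPred_isDerivation.comp hL) (.and
      (hR.comp (Primrec.pair hl (Primrec.pair Primrec.fst hL)))
      (.mem (Primrec.pair (Primrec.const e) (Primrec.pair hx hv)) hL)))
      (.and (primrecPred_isDerivation.comp hM) (.and
        (primrecPred_readsFrom.comp (Primrec.pair hl hM))
        (.mem (Primrec.pair hx (Primrec.pair hx hv)) hM)))
  · constructor
    · rintro ⟨L, hL, hF, c, v, hcL, hv⟩
      obtain ⟨M, hM, hA, hcM⟩ := OracleCode.mem_eval_iff.1 hv
      obtain ⟨m, hm⟩ := (hRS q L).2 hF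
      obtain ⟨n, hn⟩ := hA.exists_readsFrom
      exact ⟨((L, M), (c.index, v)), max m n, ⟨hL, hm _ (le_max_left _ _), hcL⟩, hM,
        hn.mono (le_max_right _ _), hcM⟩
    · rintro ⟨⟨⟨L, M⟩, x, v⟩, n, ⟨hL, hF, hcL⟩, hM, hA, hcM⟩
      obtain ⟨c, rfl⟩ := OracleCode.index_surjective x
      exact ⟨L, hL, (hRS q L).1 n hF, c, v, hcL, hM.sound hA.correctFor c _ _ hcM⟩

/-- If no extension of `p` forces the `e`-th function computable in `(R ⊕ f)'` to meet the
diagonal function of `∅'`, then `p` does not force this function to be total. -/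
theorem exists_not_forced_value {e : ℕ} {p : LockCondition}
    (hp : ∀ q ≤ p, q ∉ forcesDiagonal e) :
    ∃ x, ∀ q ≤ p, ∀ L, IsDerivation L → ForcesFacts q L → ∀ v, (e, x, v) ∉ L := by
  by_contra! htot
  obtain ⟨R, hR, hRS⟩ := exists_primrec_forcesFacts
  -- With $\emptyset'$, find for each `x` an extension of `p` and a value that it forces. The
  -- conditions found for different `x` may be incompatible; only the single input chosen below
  -- matters.
  obtain ⟨f, hf, hsound, hdom⟩ := exists_search (turingJump ∅) (α := ℕ)
    (β := ℕ × LockCondition × List ComputationFact)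
    (R := fun x b l => b.2.1 ≤ p ∧ IsDerivation b.2.2 ∧ R l b.2.1 b.2.2 ∧ (e, x, b.1) ∈ b.2.2) (by
      have hv : Primrec fun p : ℕ × (ℕ × LockCondition × List ComputationFact) × List ℕ =>
        p.2.1.1 := Primrec.fst.comp (Primrec.fst.comp Primrec.snd)
      have hq : Primrec fun p : ℕ × (ℕ × LockCondition × List ComputationFact) × List ℕ =>
        p.2.1.2.1 := Primrec.fst.comp (Primrec.snd.comp (Primrec.fst.comp Primrec.snd))
      have hL : Primrec fun p : ℕ × (ℕ × LockCondition × List ComputationFact) × List ℕ =>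
        p.2.1.2.2 := Primrec.snd.comp (Primrec.snd.comp (Primrec.fst.comp Primrec.snd))
      exact .and (LockCondition.primrecPred_le.comp (Primrec.pair hq (Primrec.const p)))
        (.and (primrecPred_isDerivation.comp hL) (.and
          (hR.comp (Primrec.pair (Primrec.snd.comp Primrec.snd) (Primrec.pair hq hL)))
          (.mem (Primrec.pair (Primrec.const e) (Primrec.pair Primrec.fst hv)) hL))))
  obtain ⟨c, hc⟩ := (OracleCode.exists_eval_eq_iff _ _).2
    (RecursiveIn.iff_nat.1 (hf.map_primrec Primrec.fst))
  -- Evaluation at the index of the searching program makes the forced value the diagonal value, so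
  -- the condition found lies in `forcesDiagonal e`.
  have hd : (f c.index).Dom := by
    obtain ⟨q, hq, L, hL, hF, v, hv⟩ := htot c.index
    obtain ⟨m, hm⟩ := (hRS q L).2 hF
    exact hdom _ ⟨(v, q, L), m, hq, hL, hm m le_rfl, hv⟩
  obtain ⟨⟨v, q, L⟩, hb⟩ := Part.dom_iff_mem.1 hd
  obtain ⟨n, hq, hL, hF, hv⟩ := hsound _ _ hb
  exact hp q hq ⟨L, hL, (hRS q L).1 n hF, c, v, hv, by rw [hc]; exact Part.mem_map _ hb⟩

/-- Meeting `forcesDiagonal` gives the agreement at once. Avoiding it leaves an input with no forced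
value below some `p` in the filter, yet the actual computation there is forced by some `q` in the
filter, hence by a common extension of `p` and `q`. -/
theorem IsNGeneric.exists_meets_diagonal {G : Order.PFilter LockCondition} (hG : IsNGeneric 2 G)
    {d : OracleCode} (hd : ∀ x, (d.eval (turingJump (genericJoin G)) x).Dom) :
    ∃ (c : OracleCode) (v : ℕ), v ∈ d.eval (turingJump (genericJoin G)) c.index ∧
      v ∈ c.eval (turingJump ∅) c.index := by
  rcases hG _ (isSigmaZero_forcesDiagonal d.index) with
    ⟨q, hq, L, hL, hF, c, v, hcL, hv⟩ | ⟨p, hp, hpW⟩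
  · exact ⟨c, v, hL.sound (hG.correctFor_turingJump_iff.2 ⟨q, hq, hF⟩) d _ _ hcL, hv⟩
  · obtain ⟨x, hx⟩ := exists_not_forced_value hpW
    obtain ⟨v, hv⟩ := Part.dom_iff_mem.1 (hd x)
    obtain ⟨L, hL, hA, hdL⟩ := OracleCode.mem_eval_iff.1 hv
    obtain ⟨q, hq, hF⟩ := hG.correctFor_turingJump_iff.1 hA
    obtain ⟨r, -, hrp, hrq⟩ := G.exists_le_le hp hq
    exact absurd hdL (hx r hrp L hL (fun t ht h4 => (hF t ht h4).mono hrq) v)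

theorem mainTheorem5 :
    ∃ n : ℕ, ∀ G : Order.PFilter LockCondition, IsNGeneric n G →
      ¬ IsPADegreeRelativeTo
          (turingJump (turingJoin (genericSequence G) (genericLocks G)))
          (turingJump ∅) := by
  refine ⟨2, fun G hG hPA => ?_⟩
  obtain ⟨P, hP, hPT⟩ := hPA _ (isBinaryTree_diagonalTree _) (infinite_diagonalTree _)
    (isComputableIn_diagonalTree _)
  obtain ⟨d, hd⟩ := (OracleCode.exists_eval_eq_iff _ _).2 hP
  have hd' : ∀ x, d.eval (turingJump (genericJoin G)) x = Part.some (encode (P x)) := by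
    intro x
    rw [hd]
    simp
  obtain ⟨c, v, hv, hcv⟩ := hG.exists_meets_diagonal (d := d) fun x => by rw [hd']; trivial
  rw [hd'] at hv
  obtain rfl := Part.mem_some_iff.1 hv
  exact isPathThrough_diagonalTree_iff.1 hPT c hcv
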